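/- Let $G$ be a group with neutral element $\varepsilon$ (not necessarily abelian), and let $R=\bigoplus_{g\in G}R_g$ be a $G$-graded ring which is graded left Artinian, i.e. its graded left ideals satisfy the descending chain condition. Let $R\text{-gr}$ be the category of graded left $R$-modules: its objects are left $R$-modules $M=\bigoplus_{g\in G}M_g$ with $R_gM_h\subseteq M_{gh}$, and its morphisms are the $R$-linear maps $f:M\to N$ with $f(M_g)\subseteq N_g$ for all $g\in G$. For $\sigma\in G$ the shift $M(\sigma)$ is the module $M$ with grading $M(\sigma)_g=M_{g\sigma}$. A graded module is graded indecomposable if it is non-zero and is not the direct sum of two non-zero graded submodules. A principal graded indecomposable left $R$-module is a graded module isomorphic in $R\text{-gr}$ to one of the terms $P_i$ of a decomposition $R\simeq P_1\oplus\cdots\oplus P_n$ in $R\text{-gr}$ of the graded left module $R$ into finitely many graded indecomposable modules. Direct sums in $R\text{-gr}$ are graded by $(\bigoplus_i M_i)_g=\bigoplus_i (M_i)_g$. Then: (1) For every projective object $U$ of $R\text{-gr}$ there are a set $I$, a family $(P_i)_{i\in I}$ of principal graded indecomposable left $R$-modules and a family $(\sigma_i)_{i\in I}$ of elements of $G$ such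 that $U\simeq\bigoplus_{i\in I}P_i(\sigma_i)$ in $R\text{-gr}$. (2) This representation is unique up to permutation and isomorphism of the terms: if $(P_i)_{i\in I}$ and $(Q_j)_{j\in J}$ are families of principal graded indecomposable left $R$-modules and $(\sigma_i)_{i\in I}$, $(\tau_j)_{j\in J}$ are families of elements of $G$ such that $\bigoplus_{i\in I}P_i(\sigma_i)\simeq\bigoplus_{j\in J}Q_j(\tau_j)$ in $R\text{-gr}$, then there is a bijection $e:I\to J$ such that $P_i(\sigma_i)\simeq Q_{e(i)}(\tau_{e(i)})$ in $R\text{-gr}$ for every $i\in I$. -/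

import Mathlib

open CategoryTheory DirectSum

universe u v w

/-- A ring graded by a (not necessarily commutative, additively written) group is graded left
Artinian if its graded left ideals satisfy the descending chain condition.  (`HomogeneousIdeal`
is the type of homogeneous *left* ideals, ordered by inclusion.) -/
def IsGradedLeftArtinian {G : Type w} [AddGroup G] [DecidableEq G] {R : Type u} [Ring R]
    (𝒜 : G → AddSubgroup R) [GradedRing 𝒜] : Prop :=
  WellFoundedLT (HomogeneousIdeal 𝒜)

/-- A graded left module over the graded ring `R = ⨁ g, 𝒜 g`: a left `R`-module `M` together with
a decomposition `M = ⨁ g, M_g` into additive subgroups such that `R_g M_h ⊆ M_{g + h}`. -/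
structure GrMod {G : Type w} [AddGroup G] [DecidableEq G] {R : Type u} [Ring R]
    (𝒜 : G → AddSubgroup R) [GradedRing 𝒜] where
  carrier : Type v
  [addCommGroup : AddCommGroup carrier]
  [module : Module R carrier]
  grading : G → AddSubgroup carrier
  [decomposition : DirectSum.Decomposition grading]
  [gradedSMul : SetLike.GradedSMul 𝒜 grading]

namespace GrMod

variable {G : Type w} [AddGroup G] [DecidableEq G] {R : Type u} [Ring R]
  {𝒜 : G → AddSubgroup R} [GradedRing 𝒜]

attribute [instance] addCommGroup module decomposition gradedSMul

/-- Morphisms of graded modules: `R`-linear maps `f : M → N` with `f(M_g) ⊆ N_g` for all `g`. -/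
@[ext]
structure Hom (M N : GrMod.{u, v, w} 𝒜) where
  toLinearMap : M.carrier →ₗ[R] N.carrier
  map_mem : ∀ (g : G) (m : M.carrier), m ∈ M.grading g → toLinearMap m ∈ N.grading g

/-- The category `R-gr` of graded left `R`-modules. -/
instance : Category.{v} (GrMod.{u, v, w} 𝒜) where
  Hom M N := Hom M N
  id M := ⟨LinearMap.id, fun _ _ h => h⟩
  comp f g := ⟨g.toLinearMap.comp f.toLinearMap,
    fun i m h => g.map_mem i _ (f.map_mem i m h)⟩

/-- A family of subgroups which spans and admits a compatible family of projections is a direct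
sum decomposition. -/
theorem isInternal_of_proj {ι : Type*} [DecidableEq ι] {M : Type*} [AddCommGroup M]
    (N : ι → AddSubgroup M) (p : ι → M →+ M)
    (hp : ∀ i j, ∀ m ∈ N j, p i m = if i = j then m else 0)
    (hN : ∀ m : M, m ∈ ⨆ i, N i) : DirectSum.IsInternal N := by
  refine ⟨?_, ?_⟩
  · have key : ∀ (i : ι) (x : ⨁ i, N i), p i (DirectSum.coeAddMonoidHom N x) = (x i : M) := by
      intro i x
      induction x using DirectSum.induction_on with
      | zero => simp
      | of j y =>
        rw [DirectSum.coeAddMonoidHom_of, hp i j _ y.2, DirectSum.coe_of_apply]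
        by_cases e : i = j
        · rw [if_pos e, if_pos e.symm]
        · rw [if_neg e, if_neg (Ne.symm e)]
          rfl
      | add x y hx hy => simp [hx, hy]
    intro x y hxy
    refine DFinsupp.ext fun i => Subtype.ext ?_
    rw [← key i x, ← key i y, hxy]
  · intro m
    refine AddSubgroup.iSup_induction N (C := fun m => ∃ x, DirectSum.coeAddMonoidHom N x = m)
      (hN m) ?_ ⟨0, map_zero _⟩ ?_
    · intro i x hx
      exact ⟨DirectSum.of (fun i => N i) i ⟨x, hx⟩, DirectSum.coeAddMonoidHom_of _ _ _⟩
    · rintro _ _ ⟨x, rfl⟩ ⟨y, rfl⟩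
      exact ⟨x + y, map_add _ _ _⟩

/-- The projection of `M` onto its homogeneous component of degree `g`. -/
def proj (M : GrMod.{u, v, w} 𝒜) (g : G) : M.carrier →+ M.carrier where
  toFun m := (DirectSum.decompose M.grading m g : M.carrier)
  map_zero' := by simp
  map_add' x y := by simp

theorem proj_of_mem (M : GrMod.{u, v, w} 𝒜) (g h : G) (m : M.carrier) (hm : m ∈ M.grading h) :
    M.proj g m = if g = h then m else 0 := by
  split_ifs with e
  · subst e
    exact DirectSum.decompose_of_mem_same M.grading hm
  · exact DirectSum.decompose_of_mem_ne M.grading hm (Ne.symm e)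

theorem mem_iSup_grading (M : GrMod.{u, v, w} 𝒜) (m : M.carrier) : m ∈ ⨆ g, M.grading g := by
  induction m using DirectSum.Decomposition.inductionOn M.grading with
  | zero => exact zero_mem _
  | @homogeneous i x => exact AddSubgroup.mem_iSup_of_mem i x.2
  | add x y hx hy => exact add_mem hx hy

/-- The ring `R` as a graded left module over itself. -/
def regular (𝒜 : G → AddSubgroup R) [GradedRing 𝒜] : GrMod.{u, u, w} 𝒜 where
  carrier := R
  grading := 𝒜

theorem shift_isInternal (M : GrMod.{u, v, w} 𝒜) (σ : G) :
    DirectSum.IsInternal (fun g => M.grading (g + σ)) := by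
  refine isInternal_of_proj _ (fun g => M.proj (g + σ)) ?_ ?_
  · intro i j m hm
    rw [M.proj_of_mem _ _ m hm]
    simp
  · intro m
    have h := M.mem_iSup_grading m
    rwa [← Equiv.iSup_comp (g := M.grading) (Equiv.addRight σ)] at h

/-- The `σ`-shift `M(σ)`: the same module, with grading `M(σ)_g = M_{g + σ}`. -/
noncomputable def shift (M : GrMod.{u, v, w} 𝒜) (σ : G) : GrMod.{u, v, w} 𝒜 where
  carrier := M.carrier
  grading := fun g => M.grading (g + σ)
  decomposition := (M.shift_isInternal σ).chooseDecomposition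
  gradedSMul := ⟨fun i j a m ha hm => by
    have h := SetLike.GradedSMul.smul_mem (A := 𝒜) (B := M.grading) ha hm
    simpa only [vadd_eq_add, add_assoc] using h⟩

/-- The degree `g` component of an external direct sum: the elements all of whose coordinates are
homogeneous of degree `g`. -/
def directSumGrading {I : Type*} (M : I → GrMod.{u, v, w} 𝒜) (g : G) :
    AddSubgroup (⨁ i, (M i).carrier) where
  carrier := {x | ∀ i, x i ∈ (M i).grading g}
  zero_mem' := fun i => zero_mem ((M i).grading g)
  add_mem' := fun hx hy i => add_mem (hx i) (hy i)
  neg_mem' := fun hx i => neg_mem (hx i)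

theorem directSum_isInternal {I : Type*} (M : I → GrMod.{u, v, w} 𝒜) :
    DirectSum.IsInternal (directSumGrading M) := by
  classical
  refine isInternal_of_proj _ (fun g => DirectSum.map (fun i => (M i).proj g)) ?_ ?_
  · intro g h x hx
    refine DFinsupp.ext fun i => ?_
    rw [DirectSum.map_apply, (M i).proj_of_mem _ _ _ (hx i)]
    split_ifs <;> rfl
  · intro x
    induction x using DirectSum.induction_on with
    | zero => exact zero_mem _
    | of i m =>
      induction m using DirectSum.Decomposition.inductionOn (M i).grading with
      | zero => rw [map_zero]; exact zero_mem _
      | @homogeneous g y =>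
        refine AddSubgroup.mem_iSup_of_mem g fun j => ?_
        by_cases e : j = i
        · subst e
          rw [DirectSum.of_eq_same]
          exact y.2
        · rw [DirectSum.of_eq_of_ne _ _ _ e]
          exact zero_mem _
      | add x y hx hy => rw [map_add]; exact add_mem hx hy
    | add x y hx hy => exact add_mem hx hy

/-- The direct sum of a family of graded modules, with `(⨁ i, M_i)_g = ⨁ i, (M_i)_g`. -/
noncomputable def directSum {I : Type v} (M : I → GrMod.{u, v, w} 𝒜) : GrMod.{u, v, w} 𝒜 where
  carrier := ⨁ i, (M i).carrier
  grading := directSumGrading M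
  decomposition := (directSum_isInternal M).chooseDecomposition
  gradedSMul := ⟨fun i j a m ha hm k => by
    rw [DirectSum.smul_apply]
    exact SetLike.GradedSMul.smul_mem (A := 𝒜) (B := (M k).grading) ha (hm k)⟩

/-- A graded module is graded indecomposable if it is non-zero and is not the (internal) direct sum
of two non-zero graded submodules. -/
def IsIndecomposable (M : GrMod.{u, v, w} 𝒜) : Prop :=
  Nontrivial M.carrier ∧
    ∀ N N' : Submodule R M.carrier, N.IsHomogeneous M.grading → N'.IsHomogeneous M.grading →
      IsCompl N N' → N = ⊥ ∨ N' = ⊥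

/-- A principal graded indecomposable module: up to isomorphism in `R-gr`, one of the terms `P_i`
of a finite decomposition `R = P_1 ⊕ ... ⊕ P_n` of the graded left module `R` into graded
indecomposable modules. -/
def IsPrincipalIndecomposable (P : GrMod.{u, u, w} 𝒜) : Prop :=
  ∃ (I : Type u) (_ : Finite I) (Q : I → GrMod.{u, u, w} 𝒜),
    (∀ i, (Q i).IsIndecomposable) ∧ Nonempty (regular 𝒜 ≅ directSum Q) ∧
      ∃ i, Nonempty (P ≅ Q i)

end GrMod

/-! Write J for the graded Jacobson radical and R_0 for the component of degree zero. Two facts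
drive the proof: R_0 is left Artinian (`isArtinianRing_zero`) and J is nilpotent
(`exists_gradedRadical_pow_eq_bot`).

The endomorphisms of a principal indecomposable P form, up to reversing the product, a corner of
R_0. Fitting's argument therefore makes End P local (`isLocalRing_end_of_retract`), and shifting
does not change End P.

Uniqueness is Azumaya's argument. If End T is local, Hom(T, M) modulo the radical morphisms is a
vector space over the residue division ring of End T. For a direct sum M of objects with local
endomorphism rings, the inclusions of the summands isomorphic to T form a basis, so the number of
such summands is a dimension that depends only on M and T (`exists_equiv`). A morphism into an
infinite sum must have only finitely many components for this; that holds for T cyclic, hence the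
predicate `K` in `LocFinDecomposition`.

Existence uses the same vector spaces. Lifting bases of Hom(T, U)/rad, with T running over
representatives of the shifted principal indecomposables, gives φ : F ⟶ U that is bijective modulo
radical morphisms (`exists_family`). Between retracts of graded free modules, radical morphisms from
such T take values in J times the target (`apply_mem_gradedRadical_smul`). By Nakayama for the
nilpotent J, φ is onto. It splits because U is projective, and the idempotent complementary to the
splitting has image in JF, so it vanishes and φ is an isomorphism. -/

namespace IsLocalRing

/-! ### Noncommutative local rings and bases modulo their nonunits -/

variable {E : Type*} [Ring E] [IsLocalRing E]

theorem of_ringEquiv {F : Type*} [Ring F] (e : E ≃+* F) : IsLocalRing F := by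
  have : Nontrivial F := e.injective.nontrivial
  refine ⟨fun {a b} h => ?_⟩
  have h' : e.symm a + e.symm b = 1 := by rw [← map_add, h, map_one]
  have key : ∀ c, IsUnit (e.symm c) → IsUnit c := fun c hc => by
    simpa using hc.map e
  exact (isUnit_or_isUnit_of_add_one h').imp (key a) (key b)

theorem eq_zero_or_eq_one_of_mul_self_eq {p : E} (hp : p * p = p) : p = 0 ∨ p = 1 := by
  rcases isUnit_or_isUnit_of_add_one (add_sub_cancel p 1) with h | h
  · exact Or.inr (h.mul_left_cancel (by rw [hp, mul_one]))
  · exact Or.inl (h.mul_left_cancel (by rw [sub_mul, one_mul, hp, sub_self, mul_zero]))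

/-- The product in the other order is idempotent, and it cannot be 0 because 1 = a(ba)b. This
Dedekind finiteness is what makes the nonunits a two-sided ideal. -/
theorem mul_eq_one_of_mul_eq_one {a b : E} (h : a * b = 1) : b * a = 1 := by
  have hi : (b * a) * (b * a) = b * a := by
    rw [mul_assoc, ← mul_assoc a b a, h, one_mul]
  refine (eq_zero_or_eq_one_of_mul_self_eq hi).resolve_left fun h0 => ?_
  have : (1 : E) = a * (b * a) * b := by rw [← mul_assoc, h, one_mul, h]
  rw [h0, mul_zero, zero_mul] at this
  exact one_ne_zero this

theorem isUnit_and_isUnit_of_isUnit_mul {a b : E} (h : IsUnit (a * b)) :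
    IsUnit a ∧ IsUnit b := by
  obtain ⟨u, hu⟩ := h
  have h1 : a * (b * ↑u⁻¹) = 1 := by rw [← mul_assoc, ← hu, Units.mul_inv]
  have h2 : (↑u⁻¹ * a) * b = 1 := by rw [mul_assoc, ← hu, Units.inv_mul]
  exact ⟨⟨⟨a, _, h1, mul_eq_one_of_mul_eq_one h1⟩, rfl⟩,
    ⟨⟨b, _, mul_eq_one_of_mul_eq_one h2, h2⟩, rfl⟩⟩

variable (E) in
/-- The two-sided ideal of nonunits of a (not necessarily commutative) local ring. -/
def nonunitsIdeal : Ideal E where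
  carrier := nonunits E
  zero_mem' := (nonunitsAddSubmonoid E).zero_mem
  add_mem' := nonunits_add
  smul_mem' _ _ hx h := hx (isUnit_and_isUnit_of_isUnit_mul h).2

theorem mem_nonunitsIdeal {a : E} : a ∈ nonunitsIdeal E ↔ ¬ IsUnit a := Iff.rfl

instance : (nonunitsIdeal E).IsTwoSided :=
  ⟨fun _ hx h => hx (isUnit_and_isUnit_of_isUnit_mul h).1⟩

instance : Nontrivial (E ⧸ nonunitsIdeal E) :=
  Ideal.Quotient.nontrivial_iff.2 fun h =>
    (h ▸ Submodule.mem_top : (1 : E) ∈ nonunitsIdeal E) isUnit_one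

/-- The residue division ring of a local ring. -/
noncomputable instance : DivisionRing (E ⧸ nonunitsIdeal E) :=
  DivisionRing.ofIsUnitOrEqZero fun a => by
    obtain ⟨a, rfl⟩ := Ideal.Quotient.mk_surjective a
    by_cases h : IsUnit a
    · exact Or.inl (h.map _)
    · exact Or.inr (Ideal.Quotient.eq_zero_iff_mem.2 h)

variable {H : Type*} [AddCommGroup H] [Module E H]

/-- A family in a module over a local ring which becomes a basis over the residue division ring
modulo the submodule `N`. -/
structure IsBasisMod (N : Submodule E H) {ι : Type*} (b : ι → H) : Prop where
  not_isUnit : ∀ (s : Finset ι) (c : ι → E), ∑ i ∈ s, c i • b i ∈ N → ∀ i ∈ s, ¬ IsUnit (c i)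
  exists_sub_mem : ∀ x, ∃ (s : Finset ι) (c : ι → E), x - ∑ i ∈ s, c i • b i ∈ N

theorem isTorsionBySet_quotient {N : Submodule E H}
    (hN : ∀ a : E, ¬ IsUnit a → ∀ x : H, a • x ∈ N) :
    Module.IsTorsionBySet E (H ⧸ N) (nonunitsIdeal E) := by
  intro x a
  obtain ⟨x, rfl⟩ := N.mkQ_surjective x
  exact (Submodule.Quotient.mk_eq_zero N).2 (hN a a.2 x)

/-- Nonunits kill H/N, so H/N is a vector space over the residue division ring, and any basis of it
can be lifted. Indexing by a subset of H/N keeps the index type in the universe of H. -/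
theorem exists_isBasisMod {N : Submodule E H} (hN : ∀ a : E, ¬ IsUnit a → ∀ x : H, a • x ∈ N) :
    ∃ (S : Set (H ⧸ N)) (b : S → H), IsBasisMod N b := by
  let _ := (isTorsionBySet_quotient hN).module
  have smul_mk : ∀ (a : E) (x : H ⧸ N), Ideal.Quotient.mk (nonunitsIdeal E) a • x = a • x :=
    fun _ _ => rfl
  let B := Module.Basis.ofVectorSpace (E ⧸ nonunitsIdeal E) (H ⧸ N)
  choose b hb using fun i => N.mkQ_surjective (B i)
  refine ⟨_, b, ⟨fun s c hc i hi => ?_, fun x => ?_⟩⟩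
  · rw [← mem_nonunitsIdeal, ← Ideal.Quotient.eq_zero_iff_mem]
    refine linearIndependent_iff'.1 B.linearIndependent s
      (fun i => Ideal.Quotient.mk (nonunitsIdeal E) (c i)) ?_ i hi
    simp only [smul_mk, ← hb, ← map_smul, ← map_sum]
    exact (Submodule.Quotient.mk_eq_zero N).2 hc
  · choose c hc using fun i => Ideal.Quotient.mk_surjective (B.repr (N.mkQ x) i)
    refine ⟨(B.repr (N.mkQ x)).support, c, ?_⟩
    rw [← Submodule.Quotient.mk_eq_zero, ← Submodule.mkQ_apply, map_sub, sub_eq_zero]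
    conv_lhs => rw [← B.linearCombination_repr (N.mkQ x), Finsupp.linearCombination_apply]
    rw [map_sum]
    refine Finset.sum_congr rfl fun i _ => ?_
    beta_reduce
    rw [← hc, smul_mk, ← hb, map_smul]

/-- Invariance of dimension: both families reduce to bases of the same vector space H/N. -/
theorem IsBasisMod.nonempty_equiv {N : Submodule E H}
    (hN : ∀ a : E, ¬ IsUnit a → ∀ x : H, a • x ∈ N) {ι κ : Type v} {b : ι → H} {b' : κ → H}
    (hb : IsBasisMod N b) (hb' : IsBasisMod N b') : Nonempty (ι ≃ κ) := by
  let _ := (isTorsionBySet_quotient hN).module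
  have smul_mk : ∀ (a : E) (x : H ⧸ N), Ideal.Quotient.mk (nonunitsIdeal E) a • x = a • x :=
    fun _ _ => rfl
  have key : ∀ {ι : Type v} {b : ι → H}, IsBasisMod N b →
      Nonempty (Module.Basis ι (E ⧸ nonunitsIdeal E) (H ⧸ N)) := by
    intro ι b hb
    refine ⟨Module.Basis.mk (v := fun i => N.mkQ (b i)) (linearIndependent_iff'.2 ?_) ?_⟩
    · intro s c hc i hi
      choose d hd using fun i => Ideal.Quotient.mk_surjective (c i)
      rw [← hd, Ideal.Quotient.eq_zero_iff_mem]
      refine hb.not_isUnit s d ?_ i hi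
      rw [← Submodule.Quotient.mk_eq_zero, ← Submodule.mkQ_apply, map_sum, ← hc]
      refine Finset.sum_congr rfl fun i _ => ?_
      rw [← hd, smul_mk, map_smul]
    · rintro x -
      obtain ⟨x, rfl⟩ := N.mkQ_surjective x
      obtain ⟨s, c, h⟩ := hb.exists_sub_mem x
      rw [← Submodule.Quotient.mk_eq_zero, ← Submodule.mkQ_apply, map_sub, sub_eq_zero] at h
      rw [h, map_sum]
      refine Submodule.sum_mem _ fun i _ => ?_
      rw [map_smul, ← smul_mk]
      exact Submodule.smul_mem _ _ (Submodule.subset_span ⟨i, rfl⟩)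
  obtain ⟨B⟩ := key hb
  obtain ⟨B'⟩ := key hb'
  exact ⟨B.indexEquiv B'⟩

end IsLocalRing

/-! ### Radical morphisms and the Krull-Schmidt-Azumaya argument in a preadditive category -/

namespace CategoryTheory

variable {C : Type w} [Category.{v} C] [Preadditive C]

instance isLocalRing_mulOpposite {E : Type*} [Ring E] [IsLocalRing E] : IsLocalRing Eᵐᵒᵖ :=
  ⟨fun {a b} h => by
    have h' : b.unop + a.unop = 1 := by
      rw [add_comm, ← MulOpposite.unop_add, h, MulOpposite.unop_one]
    exact (IsLocalRing.isUnit_or_isUnit_of_add_one h').symm.imp (fun h => h.op) (fun h => h.op)⟩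

/-- f is a split monomorphism, so it defines an idempotent of the local ring End Y, which is 0 or 1.
The value 0 would force f = 0 and then 1 = 0 in End X. -/
theorem isIso_of_isIso_comp {X Y : C} [Nontrivial (End X)] [IsLocalRing (End Y)]
    (f : X ⟶ Y) (g : Y ⟶ X) [IsIso (f ≫ g)] : IsIso f := by
  have h1 : f ≫ (g ≫ inv (f ≫ g)) = 𝟙 X := by rw [← Category.assoc, IsIso.hom_inv_id]
  let p : End Y := (g ≫ inv (f ≫ g)) ≫ f
  have hp : p * p = p := by
    change ((g ≫ inv (f ≫ g)) ≫ f) ≫ ((g ≫ inv (f ≫ g)) ≫ f) = (g ≫ inv (f ≫ g)) ≫ f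
    rw [Category.assoc, ← Category.assoc f, h1, Category.id_comp]
  rcases IsLocalRing.eq_zero_or_eq_one_of_mul_self_eq hp with h | h
  · exfalso
    have h2 : f ≫ p = f := by
      change f ≫ ((g ≫ inv (f ≫ g)) ≫ f) = f
      rw [← Category.assoc, h1, Category.id_comp]
    have h3 : f = 0 := by
      rw [← h2, h]
      exact Limits.comp_zero
    have h4 : f ≫ (g ≫ inv (f ≫ g)) = 0 := by simp only [h3, Limits.zero_comp]
    rw [h4] at h1
    exact zero_ne_one (α := End X) h1
  · exact ⟨⟨_, h1, h⟩⟩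

theorem mulOpposite_smul_eq {X M : C} (a : (End X)ᵐᵒᵖ) (f : X ⟶ M) : a • f = a.unop ≫ f := rfl

/-- The radical morphisms out of an object with local endomorphism ring. -/
def radHom (X M : C) [IsLocalRing (End X)] : Submodule (End X)ᵐᵒᵖ (X ⟶ M) where
  carrier := {f | ∀ g : M ⟶ X, ¬ IsUnit (M := End X) (f ≫ g)}
  zero_mem' g := by
    rw [Limits.zero_comp]
    exact not_isUnit_zero (M₀ := End X)
  add_mem' hf hf' g := by
    rw [Preadditive.add_comp]
    exact IsLocalRing.nonunits_add (R := End X) (hf g) (hf' g)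
  smul_mem' a f hf g := by
    rw [mulOpposite_smul_eq, Category.assoc]
    exact fun h => hf g (IsLocalRing.isUnit_and_isUnit_of_isUnit_mul (E := End X) h).1

theorem mem_radHom {X M : C} [IsLocalRing (End X)] {f : X ⟶ M} :
    f ∈ radHom X M ↔ ∀ g : M ⟶ X, ¬ IsIso (f ≫ g) := by
  exact forall_congr' fun g => not_congr (isUnit_iff_isIso _)

theorem comp_mem_radHom {X M M' : C} [IsLocalRing (End X)] {f : X ⟶ M} (hf : f ∈ radHom X M)
    (h : M ⟶ M') : f ≫ h ∈ radHom X M' := by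
  rw [mem_radHom] at hf ⊢
  intro g
  rw [Category.assoc]
  exact hf _

/-- If a ≫ f ≫ g were invertible, a would be too, and conjugating by a would make f ≫ (g ≫ a)
invertible. -/
theorem comp_mem_radHom' {X Y M : C} [IsLocalRing (End X)] [IsLocalRing (End Y)] {f : X ⟶ M}
    (hf : f ∈ radHom X M) (a : Y ⟶ X) : a ≫ f ∈ radHom Y M := by
  rw [mem_radHom] at hf ⊢
  intro g hg
  rw [Category.assoc] at hg
  have ha : IsIso a := isIso_of_isIso_comp a (f ≫ g)
  refine hf (g ≫ a) ?_
  have : f ≫ g ≫ a = inv a ≫ (a ≫ f ≫ g) ≫ a := by simp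
  rw [this]
  infer_instance

theorem mem_radHom_of_not_isIso {X Y : C} [IsLocalRing (End X)] [IsLocalRing (End Y)] {f : X ⟶ Y}
    (hf : ¬ IsIso f) : f ∈ radHom X Y := by
  rw [mem_radHom]
  exact fun g _ => hf (isIso_of_isIso_comp f g)

theorem smul_mem_radHom_of_not_isUnit {X M : C} [IsLocalRing (End X)] (a : (End X)ᵐᵒᵖ)
    (ha : ¬ IsUnit a) (f : X ⟶ M) : a • f ∈ radHom X M := by
  rw [mulOpposite_smul_eq]
  refine comp_mem_radHom (mem_radHom_of_not_isIso fun h => ha ?_) f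
  exact ((isUnit_iff_isIso _).2 h).op

/-- A decomposition of `M` as a direct sum of the objects `X i`, in the sense that the morphisms
into `M` from the objects satisfying `K` are finite sums of their components. -/
structure LocFinDecomposition (K : C → Prop) (M : C) {I : Type*} (X : I → C) where
  ι : ∀ i, X i ⟶ M
  π : ∀ i, M ⟶ X i
  ι_π_self : ∀ i, ι i ≫ π i = 𝟙 _
  ι_π_ne : ∀ i j, i ≠ j → ι i ≫ π j = 0
  exists_sum : ∀ T, K T → ∀ f : T ⟶ M, ∃ s : Finset I, f = ∑ i ∈ s, (f ≫ π i) ≫ ι i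

namespace LocFinDecomposition

variable {K : C → Prop} {M : C} {I : Type*} {X : I → C}

theorem ι_π_self_assoc (D : LocFinDecomposition K M X) (i : I) {Z : C} (h : X i ⟶ Z) :
    D.ι i ≫ D.π i ≫ h = h := by
  rw [← Category.assoc, D.ι_π_self, Category.id_comp]

theorem ι_π_ne_assoc (D : LocFinDecomposition K M X) (i j : I) (hij : i ≠ j) {Z : C}
    (h : X j ⟶ Z) : D.ι i ≫ D.π j ≫ h = 0 := by
  rw [← Category.assoc, D.ι_π_ne i j hij, Limits.zero_comp]

/-- Transport of a decomposition along an isomorphism. -/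
def ofIso (D : LocFinDecomposition K M X) {M' : C} (e : M ≅ M') :
    LocFinDecomposition K M' X where
  ι i := D.ι i ≫ e.hom
  π i := e.inv ≫ D.π i
  ι_π_self i := by simp [D.ι_π_self]
  ι_π_ne i j h := by simp [D.ι_π_ne i j h]
  exists_sum T hT f := by
    obtain ⟨s, hs⟩ := D.exists_sum T hT (f ≫ e.inv)
    refine ⟨s, ?_⟩
    rw [← cancel_mono e.inv, hs, Preadditive.sum_comp]
    simp

-- Summands not isomorphic to T contribute only radical morphisms, since a non-isomorphism between
-- objects with local endomorphism rings is radical. The summands isomorphic to T are independent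
-- because the projections recover the coefficients.
open Classical in
theorem isBasisMod (D : LocFinDecomposition K M X) [∀ i, IsLocalRing (End (X i))] (T : C)
    [IsLocalRing (End T)] (hT : K T) (φ : ∀ i : {i // Nonempty (T ≅ X i)}, T ≅ X i) :
    IsLocalRing.IsBasisMod (radHom T M) (fun i => (φ i).hom ≫ D.ι i) := by
  refine ⟨fun s c hc i hi hu => ?_, fun f => ?_⟩
  -- This test morphism extracts the i-th coefficient as an endomorphism of T; a unit there would
  -- contradict radicality of the sum.
  · refine mem_radHom.1 hc (D.π i ≫ (φ i).inv) ?_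
    have : (∑ j ∈ s, c j • (φ j).hom ≫ D.ι j) ≫ D.π i ≫ (φ i).inv = (c i).unop := by
      rw [Preadditive.sum_comp, Finset.sum_eq_single_of_mem i hi]
      · simp [mulOpposite_smul_eq, D.ι_π_self_assoc]
      · intro j _ hj
        simp [mulOpposite_smul_eq, D.ι_π_ne_assoc j i (fun h => hj (Subtype.ext h))]
    rw [this, ← isUnit_iff_isIso]
    exact hu.unop
  · obtain ⟨s, hs⟩ := D.exists_sum T hT f
    refine ⟨s.subtype _, fun i => MulOpposite.op (f ≫ D.π i ≫ (φ i).inv), ?_⟩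
    have h1 : ∑ i ∈ s.subtype (fun i => Nonempty (T ≅ X i)),
        (MulOpposite.op (f ≫ D.π i ≫ (φ i).inv) : (End T)ᵐᵒᵖ) • (φ i).hom ≫ D.ι i =
        ∑ i ∈ s with Nonempty (T ≅ X i), (f ≫ D.π i) ≫ D.ι i := by
      rw [← Finset.sum_subtype_eq_sum_filter]
      refine Finset.sum_congr rfl fun i _ => ?_
      simp [mulOpposite_smul_eq]
    rw [h1, sub_eq_iff_eq_add'.2 (hs.trans
      (Finset.sum_filter_add_sum_filter_not s (fun i => Nonempty (T ≅ X i)) _).symm)]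
    refine Submodule.sum_mem _ fun i hi => comp_mem_radHom (mem_radHom_of_not_isIso fun h => ?_) _
    exact (Finset.mem_filter.1 hi).2 ⟨asIso (f ≫ D.π i)⟩

/-- The Krull-Schmidt-Azumaya uniqueness theorem. -/
theorem exists_equiv {I J : Type u} {X : I → C} {Y : J → C} (D : LocFinDecomposition K M X)
    (D' : LocFinDecomposition K M Y) [∀ i, IsLocalRing (End (X i))]
    [∀ j, IsLocalRing (End (Y j))] (hX : ∀ i, K (X i)) (hY : ∀ j, K (Y j)) :
    ∃ e : I ≃ J, ∀ i, Nonempty (X i ≅ Y (e i)) := by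
  have key : ∀ (T : C) [IsLocalRing (End T)], K T →
      Nonempty ({i // Nonempty (T ≅ X i)} ≃ {j // Nonempty (T ≅ Y j)}) := by
    intro T _ hT
    exact (D.isBasisMod T hT fun i => i.2.some).nonempty_equiv smul_mem_radHom_of_not_isUnit
      (D'.isBasisMod T hT fun i => i.2.some)
  have mk_eq : ∀ {T Z : C}, _root_.Quotient.mk (isIsomorphicSetoid C) Z = ⟦T⟧ ↔ Nonempty (T ≅ Z) :=
    fun {T Z} => _root_.Quotient.eq.trans ⟨fun ⟨e⟩ => ⟨e.symm⟩, fun ⟨e⟩ => ⟨e.symm⟩⟩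
  -- The bijection is assembled fibrewise over isomorphism classes. A class met by either family is
  -- represented by a member of it, which serves as T; for any other class both fibres are empty.
  have main : ∀ c : _root_.Quotient (isIsomorphicSetoid C),
      Nonempty ({i // (⟦X i⟧ : _root_.Quotient (isIsomorphicSetoid C)) = c} ≃
        {j // (⟦Y j⟧ : _root_.Quotient (isIsomorphicSetoid C)) = c}) := by
    intro c
    by_cases h : ∃ i, ⟦X i⟧ = c
    · obtain ⟨i, rfl⟩ := h
      simp only [mk_eq]
      exact key (X i) (hX i)
    · by_cases h' : ∃ j, ⟦Y j⟧ = c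
      · obtain ⟨j, rfl⟩ := h'
        simp only [mk_eq]
        exact key (Y j) (hY j)
      · have : IsEmpty {i // (⟦X i⟧ : _root_.Quotient (isIsomorphicSetoid C)) = c} :=
          ⟨fun i => h ⟨i, i.2⟩⟩
        have : IsEmpty {j // (⟦Y j⟧ : _root_.Quotient (isIsomorphicSetoid C)) = c} :=
          ⟨fun j => h' ⟨j, j.2⟩⟩
        exact ⟨Equiv.equivOfIsEmpty _ _⟩
  refine ⟨Equiv.ofFiberEquiv fun c => (main c).some, fun i => ?_⟩
  exact mk_eq.1 (Equiv.ofFiberEquiv_map (fun c => (main c).some) i)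

open Classical in
/-- Every object receives a morphism from a direct sum of objects with local endomorphism rings,
which is bijective on morphisms modulo radical morphisms. -/
theorem exists_family {κ : Type v} (X : κ → C) [∀ t, IsLocalRing (End (X t))]
    (hX : ∀ t, K (X t)) (U : C) :
    ∃ (I : Type v) (k : I → κ) (b : ∀ i, X (k i) ⟶ U),
      ∀ (F : C) (D : LocFinDecomposition K F (fun i => X (k i))) (φ : F ⟶ U),
        (∀ i, D.ι i ≫ φ = b i) → ∀ t,
          (∀ f : X t ⟶ U, ∃ x : X t ⟶ F, f - x ≫ φ ∈ radHom (X t) U) ∧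
          (∀ x : X t ⟶ F, x ≫ φ ∈ radHom (X t) U → x ∈ radHom (X t) F) := by
  -- One basis is chosen per isomorphism class, not per index: using isomorphic `X t` twice would
  -- destroy injectivity modulo the radical.
  let S : Setoid κ := (isIsomorphicSetoid C).comap X
  choose B b hb using fun c : _root_.Quotient S =>
    IsLocalRing.exists_isBasisMod (N := radHom (X c.out) U) smul_mem_radHom_of_not_isUnit
  refine ⟨Σ c, B c, fun i => i.1.out, fun i => b i.1 i.2, fun F D φ hφ t => ?_⟩
  obtain ⟨e⟩ : Nonempty (X (⟦t⟧ : _root_.Quotient S).out ≅ X t) := _root_.Quotient.mk_out t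
  refine ⟨fun f => ?_, fun x hx => ?_⟩
  · obtain ⟨s, c, h⟩ := (hb ⟦t⟧).exists_sub_mem (e.hom ≫ f)
    refine ⟨∑ j ∈ s, e.inv ≫ (c j).unop ≫ D.ι ⟨⟦t⟧, j⟩, ?_⟩
    have := comp_mem_radHom' h e.inv
    rw [Preadditive.comp_sub, e.inv_hom_id_assoc, Preadditive.comp_sum] at this
    rw [Preadditive.sum_comp]
    have h5 : ∀ j, (e.inv ≫ (c j).unop ≫ D.ι ⟨⟦t⟧, j⟩) ≫ φ = e.inv ≫ (c j • b ⟦t⟧ j) :=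
      fun j => by rw [Category.assoc, Category.assoc, hφ, mulOpposite_smul_eq]
    simp only [h5]
    exact this
  · obtain ⟨s, hs⟩ := D.exists_sum (X t) (hX t) x
    -- Components in summands of another class are automatically radical, so only the class of t
    -- needs the independence of the chosen basis.
    have hne : ∀ i : Σ c, B c, i ∉ Set.range (Sigma.mk (⟦t⟧ : _root_.Quotient S)) →
        x ≫ D.π i ∈ radHom (X t) (X i.1.out) := by
      rintro ⟨c, j⟩ hi
      refine mem_radHom_of_not_isIso fun h => hi ?_
      have : c = ⟦t⟧ := by
        rw [← _root_.Quotient.out_eq c]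
        exact _root_.Quotient.sound ⟨(asIso (x ≫ D.π ⟨c, j⟩)).symm⟩
      subst this
      exact ⟨j, rfl⟩
    have hinj : Set.InjOn (Sigma.mk (β := fun c => B c) (⟦t⟧ : _root_.Quotient S))
        (Sigma.mk (β := fun c => B c) (⟦t⟧ : _root_.Quotient S) ⁻¹' (s : Set (Σ c, B c))) :=
      fun _ _ _ _ h => eq_of_heq (Sigma.mk.inj h).2
    have h1 : ∑ i ∈ s with i ∈ Set.range (Sigma.mk (⟦t⟧ : _root_.Quotient S)),
        (x ≫ D.π i) ≫ b i.1 i.2 ∈ radHom (X t) U := by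
      have h2 : x ≫ φ = ∑ i ∈ s, (x ≫ D.π i) ≫ b i.1 i.2 := by
        conv_lhs => rw [hs, Preadditive.sum_comp]
        simp only [Category.assoc, hφ]
      rw [h2, ← Finset.sum_filter_add_sum_filter_not s
        (fun i => i ∈ Set.range (Sigma.mk (⟦t⟧ : _root_.Quotient S)))] at hx
      refine (Submodule.add_mem_iff_left _ (Submodule.sum_mem _ fun i hi => ?_)).1 hx
      exact comp_mem_radHom (hne i (Finset.mem_filter.1 hi).2) _
    rw [← Finset.sum_preimage' _ _ hinj] at h1
    have h3 := comp_mem_radHom' h1 e.hom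
    rw [Preadditive.comp_sum] at h3
    have h4 := (hb ⟦t⟧).not_isUnit (s.preimage _ hinj)
      (fun j => MulOpposite.op (e.hom ≫ x ≫ D.π ⟨⟦t⟧, j⟩)) (by
        convert h3 using 2 with j hj
        simp [mulOpposite_smul_eq])
    rw [hs]
    refine Submodule.sum_mem _ fun i hi => comp_mem_radHom ?_ _
    by_cases hr : i ∈ Set.range (Sigma.mk (⟦t⟧ : _root_.Quotient S))
    · obtain ⟨j, rfl⟩ := hr
      refine mem_radHom_of_not_isIso fun h => h4 j (Finset.mem_preimage.2 hi) ?_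
      refine IsUnit.op ((isUnit_iff_isIso _).2 ?_)
      exact inferInstanceAs (IsIso (e.hom ≫ (x ≫ D.π ⟨⟦t⟧, j⟩)))
    · exact hne i hr

end LocFinDecomposition

end CategoryTheory

/-! ### The preadditive category of graded modules: shifts, direct sums, cyclic projectives -/

namespace GrMod

variable {G : Type w} [AddGroup G] [DecidableEq G] {R : Type u} [Ring R]
  {𝒜 : G → AddSubgroup R} [GradedRing 𝒜]

theorem hom_ext {M N : GrMod.{u, v, w} 𝒜} {f g : M ⟶ N}
    (h : ∀ x, f.toLinearMap x = g.toLinearMap x) : f = g :=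
  Hom.ext (LinearMap.ext h)

@[simp] theorem comp_apply {L M N : GrMod.{u, v, w} 𝒜} (f : L ⟶ M) (g : M ⟶ N) (x : L.carrier) :
    (f ≫ g).toLinearMap x = g.toLinearMap (f.toLinearMap x) := rfl

/-- Morphisms of graded modules as an additive subgroup of the linear maps. -/
def homSubgroup (M N : GrMod.{u, v, w} 𝒜) : AddSubgroup (M.carrier →ₗ[R] N.carrier) where
  carrier := {f | ∀ (g : G) (m : M.carrier), m ∈ M.grading g → f m ∈ N.grading g}
  zero_mem' g _ _ := zero_mem (N.grading g)
  add_mem' ha hb g m hm := add_mem (ha g m hm) (hb g m hm)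
  neg_mem' ha g m hm := neg_mem (ha g m hm)

/-- Morphisms of graded modules are the elements of `homSubgroup`. -/
def homEquiv (M N : GrMod.{u, v, w} 𝒜) : (M ⟶ N) ≃ homSubgroup M N where
  toFun f := ⟨f.toLinearMap, f.map_mem⟩
  invFun f := ⟨f.1, f.2⟩

instance (M N : GrMod.{u, v, w} 𝒜) : AddCommGroup (M ⟶ N) := (homEquiv M N).addCommGroup

@[simp] theorem add_apply {M N : GrMod.{u, v, w} 𝒜} (f g : M ⟶ N) (x : M.carrier) :
    (f + g).toLinearMap x = f.toLinearMap x + g.toLinearMap x := rfl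

@[simp] theorem sub_apply {M N : GrMod.{u, v, w} 𝒜} (f g : M ⟶ N) (x : M.carrier) :
    (f - g).toLinearMap x = f.toLinearMap x - g.toLinearMap x := rfl

instance : Preadditive (GrMod.{u, v, w} 𝒜) where
  add_comp _ _ _ f f' g := hom_ext fun x => by simp
  comp_add _ _ _ f g g' := hom_ext fun x => by simp

/-- Evaluation at an element, as an additive map. -/
def evalHom {M : GrMod.{u, v, w} 𝒜} (N : GrMod.{u, v, w} 𝒜) (x : M.carrier) :
    (M ⟶ N) →+ N.carrier where
  toFun f := f.toLinearMap x
  map_zero' := rfl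
  map_add' _ _ := rfl

theorem sum_apply {M N : GrMod.{u, v, w} 𝒜} {I : Type*} (s : Finset I) (f : I → (M ⟶ N))
    (x : M.carrier) :
    (∑ i ∈ s, f i).toLinearMap x = ∑ i ∈ s, (f i).toLinearMap x :=
  map_sum (evalHom N x) f s

theorem hom_proj {M N : GrMod.{u, v, w} 𝒜} (f : M ⟶ N) (g : G) (x : M.carrier) :
    f.toLinearMap (M.proj g x) = N.proj g (f.toLinearMap x) := by
  induction x using DirectSum.Decomposition.inductionOn M.grading with
  | zero => simp
  | @homogeneous h y =>
    rw [M.proj_of_mem g h y y.2, N.proj_of_mem g h _ (f.map_mem h y y.2)]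
    split_ifs <;> simp
  | add x y hx hy => simp [hx, hy]

theorem proj_mem (M : GrMod.{u, v, w} 𝒜) (g : G) (x : M.carrier) : M.proj g x ∈ M.grading g :=
  (DirectSum.decompose M.grading x g).2

theorem proj_of_mem_same (M : GrMod.{u, v, w} 𝒜) {g : G} {x : M.carrier} (hx : x ∈ M.grading g) :
    M.proj g x = x := by
  rw [M.proj_of_mem g g x hx, if_pos rfl]

theorem mem_grading_of_injective {M N : GrMod.{u, v, w} 𝒜} (f : M ⟶ N)
    (hf : Function.Injective f.toLinearMap) {g : G} {x : M.carrier}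
    (hx : f.toLinearMap x ∈ N.grading g) : x ∈ M.grading g := by
  have : M.proj g x = x := hf (by rw [hom_proj, N.proj_of_mem_same hx])
  rw [← this]
  exact M.proj_mem g x

/-- A bijective morphism of graded modules is an isomorphism. -/
noncomputable def isoOfBijective {M N : GrMod.{u, v, w} 𝒜} (f : M ⟶ N)
    (hf : Function.Bijective f.toLinearMap) : M ≅ N where
  hom := f
  inv := ⟨(LinearEquiv.ofBijective f.toLinearMap hf).symm, fun g m hm => by
    refine mem_grading_of_injective f hf.1 ?_
    rwa [LinearEquiv.coe_coe, ← LinearEquiv.ofBijective_apply (f := f.toLinearMap) (hf := hf),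
      LinearEquiv.apply_symm_apply]⟩
  hom_inv_id := hom_ext fun x => (LinearEquiv.ofBijective f.toLinearMap hf).symm_apply_apply x
  inv_hom_id := hom_ext fun x => (LinearEquiv.ofBijective f.toLinearMap hf).apply_symm_apply x

theorem epi_of_surjective {M N : GrMod.{u, v, w} 𝒜} (f : M ⟶ N)
    (hf : Function.Surjective f.toLinearMap) : Epi f where
  left_cancellation g h e := hom_ext fun x => by
    obtain ⟨y, rfl⟩ := hf x
    rw [← comp_apply, e, comp_apply]

/-! ### Shifts -/

/-- The shift of a morphism. -/
def shiftMap {M N : GrMod.{u, v, w} 𝒜} (f : M ⟶ N) (σ : G) : M.shift σ ⟶ N.shift σ :=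
  ⟨f.toLinearMap, fun g m hm => f.map_mem (g + σ) m hm⟩

/-- Shifting does not change the endomorphism ring. -/
def endShiftEquiv (M : GrMod.{u, v, w} 𝒜) (σ : G) : End M ≃+* End (M.shift σ) where
  toFun f := shiftMap f σ
  invFun f := ⟨f.toLinearMap, fun g m hm => by
    have h := f.map_mem (g - σ) m (by
      change m ∈ M.grading (g - σ + σ)
      rwa [sub_add_cancel])
    change f.toLinearMap m ∈ M.grading (g - σ + σ) at h
    rwa [sub_add_cancel] at h⟩
  map_mul' _ _ := rfl
  map_add' _ _ := rfl

instance (M : GrMod.{u, v, w} 𝒜) (σ : G) [IsLocalRing (End M)] :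
    IsLocalRing (End (M.shift σ)) :=
  IsLocalRing.of_ringEquiv (endShiftEquiv M σ)

/-- The shift of a retract is a retract of the shift. -/
def _root_.CategoryTheory.Retract.grShift {M N : GrMod.{u, v, w} 𝒜} (r : Retract M N) (σ : G) :
    Retract (M.shift σ) (N.shift σ) where
  i := shiftMap r.i σ
  r := shiftMap r.r σ
  retract := hom_ext fun x => congr(($r.retract).toLinearMap x)

/-- The morphism from a shift of the regular module given by a homogeneous element. -/
def ofElem {M : GrMod.{u, u, w} 𝒜} {σ g : G} (m : M.carrier) (hm : m ∈ M.grading g)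
    (hg : σ + g = 0) : (regular 𝒜).shift σ ⟶ M :=
  ⟨LinearMap.toSpanSingleton R M.carrier m, fun h (r : R) (hr : r ∈ 𝒜 (h + σ)) => by
    have := SetLike.GradedSMul.smul_mem (A := 𝒜) (B := M.grading) hr hm
    rw [vadd_eq_add, add_assoc, hg, add_zero] at this
    exact this⟩

theorem one_mem_shift (σ : G) : (1 : R) ∈ ((regular 𝒜).shift σ).grading (-σ) := by
  change (1 : R) ∈ 𝒜 (-σ + σ)
  rw [neg_add_cancel]
  exact SetLike.GradedOne.one_mem

/-! ### Direct sums -/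

open Classical in
/-- The inclusion of a term into a direct sum. -/
noncomputable def ι {I : Type v} (M : I → GrMod.{u, v, w} 𝒜) (i : I) : M i ⟶ directSum M :=
  ⟨DirectSum.lof R I (fun i => (M i).carrier) i, fun g m hm j => by
    change DirectSum.of (fun i => (M i).carrier) i m j ∈ (M j).grading g
    by_cases e : j = i
    · subst e
      rwa [DirectSum.of_eq_same]
    · rw [DirectSum.of_eq_of_ne _ _ _ e]
      exact zero_mem _⟩

/-- The projection of a direct sum onto one of its terms. -/
noncomputable def π {I : Type v} (M : I → GrMod.{u, v, w} 𝒜) (i : I) : directSum M ⟶ M i :=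
  ⟨DirectSum.component R I (fun i => (M i).carrier) i, fun _ _ hm => hm i⟩

open Classical in
theorem ι_π {I : Type v} (M : I → GrMod.{u, v, w} 𝒜) (i : I) : ι M i ≫ π M i = 𝟙 _ :=
  hom_ext fun x => DirectSum.of_eq_same (β := fun i => (M i).carrier) i x

open Classical in
theorem ι_π_ne {I : Type v} (M : I → GrMod.{u, v, w} 𝒜) {i j : I} (h : i ≠ j) :
    ι M i ≫ π M j = 0 :=
  hom_ext fun x => DirectSum.of_eq_of_ne (β := fun i => (M i).carrier) i j x h.symm

open Classical in
theorem exists_eq_sum {I : Type v} (M : I → GrMod.{u, v, w} 𝒜) (x : (directSum M).carrier) :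
    ∃ s : Finset I, x = ∑ i ∈ s, (ι M i).toLinearMap ((π M i).toLinearMap x) :=
  ⟨_, (DirectSum.sum_support_of (β := fun i => (M i).carrier) x).symm⟩

open Classical in
/-- The linear map out of a direct sum given by a family of morphisms. -/
noncomputable def descLinearMap {I : Type v} {M : I → GrMod.{u, v, w} 𝒜} {N : GrMod.{u, v, w} 𝒜}
    (f : ∀ i, M i ⟶ N) : (directSum M).carrier →ₗ[R] N.carrier :=
  DirectSum.toModule R I N.carrier (fun i => (f i).toLinearMap)

open Classical in
theorem descLinearMap_ι {I : Type v} {M : I → GrMod.{u, v, w} 𝒜} {N : GrMod.{u, v, w} 𝒜}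
    (f : ∀ i, M i ⟶ N) (i : I) (x : (M i).carrier) :
    descLinearMap f ((ι M i).toLinearMap x) = (f i).toLinearMap x :=
  DirectSum.toModule_lof R (φ := fun i => (f i).toLinearMap) i x

/-- The morphism out of a direct sum given by a family of morphisms. -/
noncomputable def desc {I : Type v} {M : I → GrMod.{u, v, w} 𝒜} {N : GrMod.{u, v, w} 𝒜}
    (f : ∀ i, M i ⟶ N) : directSum M ⟶ N :=
  ⟨descLinearMap f, fun g m hm => by
    obtain ⟨s, hs⟩ := exists_eq_sum M m
    rw [hs, map_sum]
    refine sum_mem fun i _ => ?_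
    rw [descLinearMap_ι]
    exact (f i).map_mem g _ (hm i)⟩

theorem ι_desc {I : Type v} {M : I → GrMod.{u, v, w} 𝒜} {N : GrMod.{u, v, w} 𝒜}
    (f : ∀ i, M i ⟶ N) (i : I) : ι M i ≫ desc f = f i :=
  hom_ext fun x => descLinearMap_ι f i x

theorem directSum_hom_ext {I : Type v} {M : I → GrMod.{u, v, w} 𝒜} {N : GrMod.{u, v, w} 𝒜}
    {f g : directSum M ⟶ N} (h : ∀ i, ι M i ≫ f = ι M i ≫ g) : f = g :=
  hom_ext fun x => by
    obtain ⟨s, hs⟩ := exists_eq_sum M x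
    rw [hs, map_sum, map_sum]
    exact Finset.sum_congr rfl fun i _ => congr(($(h i)).toLinearMap _)

/-- Retracts of shifts of the regular module. -/
def IsCyclicProjective (T : GrMod.{u, u, w} 𝒜) : Prop :=
  ∃ σ : G, Nonempty (Retract T ((regular 𝒜).shift σ))

section Retract

variable {T M : GrMod.{u, u, w} 𝒜} {σ : G} (ρ : Retract T ((regular 𝒜).shift σ))

/-- The coordinate of an element of a retract of a shift of the regular module. -/
noncomputable def coeff : T.carrier →ₗ[R] R := ρ.i.toLinearMap

/-- The canonical generator of a retract of a shift of the regular module. -/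
noncomputable def gen : T.carrier := ρ.r.toLinearMap (1 : R)

theorem gen_mem : gen ρ ∈ T.grading (-σ) := ρ.r.map_mem _ _ (one_mem_shift (𝒜 := 𝒜) σ)

theorem hom_apply_regular (f : (regular 𝒜).shift σ ⟶ M) (r : R) :
    f.toLinearMap r = r • f.toLinearMap (1 : R) :=
  (congrArg f.toLinearMap (mul_one r).symm).trans (f.toLinearMap.map_smul r (1 : R))

theorem coeff_smul_gen (x : T.carrier) : coeff ρ x • gen ρ = x :=
  (hom_apply_regular ρ.r (coeff ρ x)).symm.trans congr(($ρ.retract).toLinearMap x)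

theorem hom_apply_eq (f : T ⟶ M) (x : T.carrier) :
    f.toLinearMap x = coeff ρ x • f.toLinearMap (gen ρ) := by
  rw [← map_smul, coeff_smul_gen]

end Retract

/-- The decomposition of a direct sum. -/
noncomputable def locFinDecomposition {I : Type u} (M : I → GrMod.{u, u, w} 𝒜) :
    LocFinDecomposition IsCyclicProjective (directSum M) M where
  ι := ι M
  π := π M
  ι_π_self := ι_π M
  ι_π_ne _ _ := ι_π_ne M
  exists_sum T hT f := by
    obtain ⟨σ, ⟨ρ⟩⟩ := hT
    -- T is generated by one element, so the finite support of the image of that element serves for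
    -- all of f.
    obtain ⟨s, hs⟩ := exists_eq_sum M (f.toLinearMap (gen ρ))
    refine ⟨s, hom_ext fun x => ?_⟩
    rw [hom_apply_eq ρ, hom_apply_eq ρ (∑ i ∈ s, (f ≫ π M i) ≫ ι M i), sum_apply]
    conv_lhs => rw [hs]
    rfl

/-- A finite decomposition of the identity into orthogonal idempotents which split. -/
noncomputable def isoDirectSum {I : Type v} [Fintype I] {M : GrMod.{u, v, w} 𝒜}
    {X : I → GrMod.{u, v, w} 𝒜} (i : ∀ k, X k ⟶ M) (p : ∀ k, M ⟶ X k)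
    (h : ∀ k, i k ≫ p k = 𝟙 _) (h0 : ∀ k l, k ≠ l → i k ≫ p l = 0)
    (hs : ∑ k, p k ≫ i k = 𝟙 M) : M ≅ directSum X where
  hom := ∑ k, p k ≫ ι X k
  inv := desc i
  hom_inv_id := by simp [Preadditive.sum_comp, ι_desc, hs]
  inv_hom_id := directSum_hom_ext fun k => by
    rw [← Category.assoc, ι_desc, Preadditive.comp_sum, Finset.sum_eq_single k]
    · simp [reassoc_of% h k]
    · intro l _ hl
      rw [← Category.assoc, h0 k l hl.symm, Limits.zero_comp]
    · simp

/-! ### The component of degree zero and the graded Jacobson radical -/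

theorem coe_decompose_mul_component (r x : R) (g : G) :
    (decompose 𝒜 (r * decompose 𝒜 x g) 0 : R) = decompose 𝒜 r (-g) * decompose 𝒜 x g := by
  rw [← neg_add_cancel g]
  exact coe_decompose_mul_add_of_right_mem 𝒜 (decompose 𝒜 x g).2

theorem coe_decompose_component_mul (r x : R) (g : G) :
    (decompose 𝒜 (decompose 𝒜 r (-g) * x) 0 : R) = decompose 𝒜 r (-g) * decompose 𝒜 x g := by
  rw [← neg_add_cancel g]
  exact coe_decompose_mul_add_of_left_mem 𝒜 (decompose 𝒜 r (-g)).2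

theorem decompose_mul_zero_right (r x : R) (hx : x ∈ 𝒜 0) :
    decompose 𝒜 (r * x) 0 = decompose 𝒜 r 0 * (⟨x, hx⟩ : 𝒜 0) :=
  Subtype.ext (by
    conv_lhs => rw [← add_zero (0 : G)]
    exact coe_decompose_mul_add_of_right_mem 𝒜 hx)

/-- The largest graded left ideal whose component of degree zero is contained in `I`. -/
def coinduced (𝒜 : G → AddSubgroup R) [GradedRing 𝒜] (I : Ideal (𝒜 0)) : HomogeneousIdeal 𝒜 where
  carrier := {x | ∀ r, decompose 𝒜 (r * x) 0 ∈ I}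
  zero_mem' r := by simp
  add_mem' hx hy r := by
    rw [mul_add, decompose_add, DirectSum.add_apply]
    exact add_mem (hx r) (hy r)
  smul_mem' a x hx r := by
    rw [smul_eq_mul, ← mul_assoc]
    exact hx _
  is_homogeneous' g x hx r := by
    have : decompose 𝒜 (r * decompose 𝒜 x g) 0 =
        decompose 𝒜 ((decompose 𝒜 r (-g) : R) * x) 0 :=
      Subtype.ext ((coe_decompose_mul_component r x g).trans
        (coe_decompose_component_mul r x g).symm)
    rw [this]
    exact hx _

theorem coe_mem_coinduced {I : Ideal (𝒜 0)} {x : 𝒜 0} :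
    (x : R) ∈ (coinduced 𝒜 I).toIdeal ↔ x ∈ I := by
  refine ⟨fun h => ?_, fun h r => ?_⟩
  · have := h 1
    rwa [one_mul, decompose_coe, of_eq_same] at this
  · rw [decompose_mul_zero_right r x x.2]
    exact I.mul_mem_left _ h

/-- Contracting `coinduced 𝒜 I` to degree zero gives back I, so the left ideals of R_0 embed, as an
ordered set, into the graded left ideals of R. -/
theorem isArtinianRing_zero (hR : IsGradedLeftArtinian 𝒜) : IsArtinianRing (𝒜 0) := by
  have : WellFoundedLT (HomogeneousIdeal 𝒜) := hR
  have hle : ∀ I I' : Ideal (𝒜 0), coinduced 𝒜 I ≤ coinduced 𝒜 I' ↔ I ≤ I' := by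
    refine fun I I' => ⟨fun h x hx => coe_mem_coinduced.1 (h (coe_mem_coinduced.2 hx)),
      fun h x hx r => h (hx r)⟩
  have : StrictMono (coinduced 𝒜) := strictMono_of_le_iff_le fun I I' => (hle I I').symm
  exact this.wellFoundedLT

/-- The graded Jacobson radical. -/
def gradedRadical (𝒜 : G → AddSubgroup R) [GradedRing 𝒜] : Ideal R :=
  (coinduced 𝒜 (Ideal.jacobson ⊥)).toIdeal

theorem isHomogeneous_gradedRadical : (gradedRadical 𝒜).IsHomogeneous 𝒜 :=
  (coinduced 𝒜 _).is_homogeneous'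

theorem exists_mul_one_sub {A : Type*} [Ring A] {x : A} (hx : x ∈ (⊥ : Ideal A).jacobson) :
    ∃ z, z * (1 - x) = 1 := by
  obtain ⟨z, hz⟩ := Ideal.mem_jacobson_iff.1 hx (-1)
  refine ⟨z, ?_⟩
  rw [Ideal.mem_bot, sub_eq_zero] at hz
  rw [mul_sub, mul_one, ← hz, mul_neg_one, neg_mul, neg_add_eq_sub]

theorem mem_jacobson_bot_of {A : Type*} [Ring A] {x : A} (hx : ∀ y, ∃ z, z * (1 - y * x) = 1) :
    x ∈ (⊥ : Ideal A).jacobson := by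
  refine Ideal.mem_jacobson_iff.2 fun y => ?_
  obtain ⟨z, hz⟩ := hx (-y)
  refine ⟨z, ?_⟩
  rw [Ideal.mem_bot, sub_eq_zero, ← hz]
  noncomm_ring

/-- Membership of homogeneous elements in the graded Jacobson radical. -/
theorem mem_gradedRadical_of {g : G} {x : R} (hx : x ∈ 𝒜 g)
    (h : ∀ s ∈ 𝒜 (-g), ∃ z ∈ 𝒜 0, z * (1 - s * x) = 1) : x ∈ gradedRadical 𝒜 := by
  intro r
  have h1 : (decompose 𝒜 (r * x) 0 : R) = decompose 𝒜 r (-g) * x := by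
    rw [← neg_add_cancel g]
    exact coe_decompose_mul_add_of_right_mem 𝒜 hx
  refine mem_jacobson_bot_of fun y => ?_
  obtain ⟨z, hz, e⟩ := h (y * decompose 𝒜 r (-g)) (by
    have := SetLike.GradedMul.mul_mem y.2 (decompose 𝒜 r (-g)).2
    rwa [zero_add] at this)
  refine ⟨⟨z, hz⟩, Subtype.ext ?_⟩
  change z * (1 - y * (decompose 𝒜 (r * x) 0 : R)) = 1
  rw [h1, ← mul_assoc, e]

theorem gradedRadical_mul_mem {x : R} (hx : x ∈ gradedRadical 𝒜) (t : R) :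
    x * t ∈ gradedRadical 𝒜 := by
  have key : ∀ g h : G, ∀ x ∈ 𝒜 g, x ∈ gradedRadical 𝒜 → ∀ t ∈ 𝒜 h, x * t ∈ gradedRadical 𝒜 := by
    intro g h x hg hx t ht
    refine mem_gradedRadical_of (SetLike.GradedMul.mul_mem hg ht) fun s hs => ?_
    have htsx : t * s * x ∈ 𝒜 0 := by
      have := SetLike.GradedMul.mul_mem (SetLike.GradedMul.mul_mem ht hs) hg
      simpa [neg_add_rev] using this
    obtain ⟨z, hz⟩ := exists_mul_one_sub (x := (⟨t * s * x, htsx⟩ : 𝒜 0)) (by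
      have := hx (t * s)
      rwa [decompose_of_mem _ htsx, of_eq_same] at this)
    have hz' : (z : R) * (1 - t * s * x) = 1 := congrArg Subtype.val hz
    -- The passage from an inverse of 1 - ba to one of 1 - ab, namely 1 + a(1 - ba)⁻¹b, with a = sx
    -- and b = t; only left inverses are needed.
    refine ⟨1 + s * x * z * t, add_mem SetLike.GradedOne.one_mem ?_, ?_⟩
    · have := SetLike.GradedMul.mul_mem (SetLike.GradedMul.mul_mem
        (SetLike.GradedMul.mul_mem hs hg) z.2) ht
      simpa [neg_add_rev, add_assoc] using this
    · have : (1 + s * x * z * t) * (1 - s * (x * t)) =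
          1 - s * x * t + s * x * (z * (1 - t * s * x)) * t := by noncomm_ring
      rw [this, hz']
      noncomm_ring
  classical
  rw [← sum_support_decompose 𝒜 x, ← sum_support_decompose 𝒜 t, Finset.sum_mul_sum]
  exact sum_mem fun g _ => sum_mem fun h _ => key g h _ (decompose 𝒜 x g).2
    (isHomogeneous_gradedRadical g hx) _ (decompose 𝒜 t h).2

instance : (gradedRadical 𝒜).IsTwoSided := ⟨fun t hx => gradedRadical_mul_mem hx t⟩

theorem _root_.Ideal.IsHomogeneous.mul' {I I' : Ideal R} (hI : I.IsHomogeneous 𝒜)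
    (hI' : I'.IsHomogeneous 𝒜) : (I * I').IsHomogeneous 𝒜 := by
  classical
  intro g x hx
  refine Submodule.mul_induction_on hx (fun a ha b hb => ?_) fun a b ha hb => ?_
  · rw [← sum_support_decompose 𝒜 a, ← sum_support_decompose 𝒜 b, Finset.sum_mul_sum,
      decompose_sum, DFinsupp.finsetSum_apply, AddSubmonoidClass.coe_finsetSum]
    refine sum_mem fun i _ => ?_
    rw [decompose_sum, DFinsupp.finsetSum_apply, AddSubmonoidClass.coe_finsetSum]
    refine sum_mem fun j _ => ?_
    have hij : (decompose 𝒜 a i * decompose 𝒜 b j : R) ∈ 𝒜 (i + j) :=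
      SetLike.GradedMul.mul_mem (decompose 𝒜 a i).2 (decompose 𝒜 b j).2
    by_cases h : i + j = g
    · subst h
      rw [decompose_of_mem_same _ hij]
      exact Ideal.mul_mem_mul (hI i ha) (hI' j hb)
    · rw [decompose_of_mem_ne _ hij h]
      exact zero_mem _
  · rw [decompose_add, DirectSum.add_apply, AddSubgroup.coe_add]
    exact add_mem ha hb

theorem isHomogeneous_span_singleton {g : G} {a : R} (ha : a ∈ 𝒜 g) :
    (Ideal.span {a} : Ideal R).IsHomogeneous 𝒜 :=
  Ideal.homogeneous_span 𝒜 _ fun _ h => ⟨g, Set.mem_singleton_iff.1 h ▸ ha⟩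

/-- Comparing components of degree g replaces x by its part of degree zero, which lies in the
Jacobson radical of R_0; hence 1 minus that part is left invertible and kills a. -/
theorem eq_zero_of_mul_eq_self {g : G} {a x : R} (ha : a ∈ 𝒜 g) (hx : x ∈ gradedRadical 𝒜)
    (h : x * a = a) : a = 0 := by
  have h0 : (decompose 𝒜 x 0 : R) * a = a := by
    have := coe_decompose_mul_add_of_right_mem 𝒜 (i := 0) ha (a := x)
    rw [← this, h, zero_add, decompose_of_mem_same _ ha]
  obtain ⟨z, hz⟩ := exists_mul_one_sub (coe_mem_coinduced.1 (isHomogeneous_gradedRadical 0 hx))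
  have hz' : (z : R) * (1 - decompose 𝒜 x 0) = 1 := congrArg Subtype.val hz
  rw [← one_mul a, ← hz', mul_assoc, sub_mul, h0, one_mul, sub_self, mul_zero]

/-- Hopkins' argument with homogeneous ideals. The powers stabilise at some I = I². If I ≠ 0, take L
minimal with IL ≠ 0 and a homogeneous a in L with Ia ≠ 0. Minimality gives Ia = L, so a = xa for
some x in I, whence a = 0. -/
theorem exists_gradedRadical_pow_eq_bot (hR : IsGradedLeftArtinian 𝒜) :
    ∃ n : ℕ, gradedRadical 𝒜 ^ n = ⊥ := by
  have hwf : WellFoundedLT (HomogeneousIdeal 𝒜) := hR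
  have hhom : ∀ n : ℕ, (gradedRadical 𝒜 ^ (n + 1)).IsHomogeneous 𝒜 := by
    intro n
    induction n with
    | zero =>
      rw [zero_add, Submodule.pow_one]
      exact isHomogeneous_gradedRadical (𝒜 := 𝒜)
    | succ n ih => 
      rw [Submodule.pow_succ]
      exact ih.mul' isHomogeneous_gradedRadical
  let f : ℕ →o (HomogeneousIdeal 𝒜)ᵒᵈ :=
    ⟨fun n => OrderDual.toDual ⟨gradedRadical 𝒜 ^ (n + 1), hhom n⟩,
      fun m n hmn => Ideal.pow_le_pow_right (Nat.succ_le_succ hmn)⟩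
  obtain ⟨n, hn⟩ := WellFoundedGT.monotone_chain_condition f
  set I := gradedRadical 𝒜 ^ (n + 1) with hI
  have hII : I * I = I := by
    rw [hI, ← Submodule.pow_add _ (Nat.succ_ne_zero n)]
    -- The chain at index k is the power k + 1, so the index n + 1 + n is the exponent 2(n + 1) of I
    -- * I.
    have := congrArg (fun L : (HomogeneousIdeal 𝒜)ᵒᵈ => (OrderDual.ofDual L).toIdeal)
      (hn (n + 1 + n) (by omega))
    exact this.symm
  refine ⟨n + 1, ?_⟩
  rw [← hI]
  by_contra hne
  obtain ⟨L, hL, hmin⟩ := hwf.wf.has_min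
    {L : HomogeneousIdeal 𝒜 | I * L.toIdeal ≠ ⊥} ⟨⟨I, hhom n⟩, by
      change I * I ≠ ⊥
      rwa [hII]⟩
  obtain ⟨g, a, haL, hag, haI⟩ : ∃ g, ∃ a ∈ L.toIdeal, a ∈ 𝒜 g ∧ I * Ideal.span {a} ≠ ⊥ := by
    classical
    by_contra! hcon
    refine hL (le_bot_iff.1 (Ideal.mul_le.2 fun x hx y hy => ?_))
    rw [← sum_support_decompose 𝒜 y, Finset.mul_sum]
    refine sum_mem fun g _ => ?_
    rw [← hcon g _ (L.is_homogeneous' g hy) (decompose 𝒜 y g).2]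
    exact Ideal.mul_mem_mul hx (Ideal.mem_span_singleton_self _)
  let L' : HomogeneousIdeal 𝒜 :=
    ⟨I * Ideal.span {a}, (hhom n).mul' (isHomogeneous_span_singleton hag)⟩
  have hle : L' ≤ L := by
    change I * Ideal.span {a} ≤ L.toIdeal
    exact Ideal.mul_le.2 fun x _ y hy => L.toIdeal.mul_mem_left _
      ((Ideal.span_singleton_le_iff_mem _).2 haL hy)
  have hL' : L' = L := by
    by_contra h
    refine hmin L' ?_ (lt_of_le_of_ne hle h)
    change I * (I * Ideal.span {a}) ≠ ⊥
    rwa [← mul_assoc, hII]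
  have ha' : a ∈ I * Ideal.span {a} := by
    change a ∈ L'.toIdeal
    rw [hL']
    exact haL
  obtain ⟨x, hx, hxa⟩ := Submodule.mem_smul_span_singleton.1 ha'
  have ha0 : a = 0 := eq_zero_of_mul_eq_self hag (Ideal.pow_le_self (Nat.succ_ne_zero n) hx) hxa
  refine haI (le_bot_iff.1 (Ideal.mul_le.2 fun x _ y hy => ?_))
  rw [ha0, Ideal.span_singleton_zero] at hy
  rw [hy, mul_zero]
  exact zero_mem _

end GrMod

/-! ### Idempotents in Artinian rings -/

section Ring

variable {A : Type*} [Ring A]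

/-- Fitting's lemma for right multiplication by a on A: for large n, A is the direct sum of the
kernel and the image of multiplication by aⁿ, and i is the component of 1 in the image. -/
theorem exists_fitting_idempotent [IsArtinianRing A] (a : A) :
    ∃ (n : ℕ) (i c : A), n ≠ 0 ∧ i * i = i ∧ i = c * a ^ n ∧ i * a ^ n = a ^ n := by
  let φ : Module.End A A := LinearMap.toSpanSingleton A A a
  have hφ : ∀ (n : ℕ) (x : A), (φ ^ n) x = x * a ^ n := by
    intro n
    induction n with
    | zero => simp
    | succ n ih =>
      intro x
      rw [pow_succ, Module.End.mul_apply, ih, pow_succ', ← mul_assoc]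
      rfl
  obtain ⟨n, hn, hn0⟩ := (φ.eventually_isCompl_ker_pow_range_pow.and
    (Filter.eventually_ne_atTop 0)).exists
  obtain ⟨k, hk, i, hi, hki⟩ := Submodule.mem_sup.1
    (hn.sup_eq_top ▸ Submodule.mem_top : (1 : A) ∈ (φ ^ n).ker ⊔ (φ ^ n).range)
  obtain ⟨c, hc⟩ := hi
  rw [hφ] at hc
  rw [LinearMap.mem_ker, hφ] at hk
  have h1 : i * k = i - i * i := by rw [eq_sub_iff_add_eq, ← mul_add, hki, mul_one]
  have h2 : i * k = 0 := by
    -- ik is in the kernel because k is, and in the image because ik = i - i².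
    refine Submodule.disjoint_def.1 hn.disjoint (i * k) ?_ ?_
    · rw [LinearMap.mem_ker, hφ, mul_assoc, hk, mul_zero]
    · rw [h1]
      refine ⟨c - i * c, ?_⟩
      rw [hφ, sub_mul, mul_assoc, hc]
  refine ⟨n, i, c, hn0, ?_, hc.symm, ?_⟩
  · rw [h1] at h2
    exact (sub_eq_zero.1 h2).symm
  · rw [← zero_add (i * a ^ n), ← hk, ← add_mul, hki, one_mul]

/-- Primitive idempotents: nonzero idempotents without nontrivial idempotents below them. -/
structure IsPrimitiveIdempotent (v : A) : Prop where
  ne_zero : v ≠ 0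
  eq_zero_or_eq : ∀ p, p * p = p → v * p = p → p * v = p → p = 0 ∨ p = v

/-- Well-founded induction on the left ideal Ae: an idempotent p strictly between 0 and e splits e
into p and e - p, each generating a strictly smaller left ideal. -/
theorem exists_primitive_decomposition [IsArtinianRing A] (e : A) (he : e * e = e) :
    ∃ (I : Type u) (_ : Fintype I) (v : I → A), (∀ i, IsPrimitiveIdempotent (v i)) ∧
      (∀ i, v i * v i = v i) ∧ (∀ i j, i ≠ j → v i * v j = 0) ∧ ∑ i, v i = e := by
  have hwf : WellFounded (fun x y : A => Ideal.span {x} < (Ideal.span {y} : Ideal A)) :=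
    InvImage.wf (fun x : A => (Ideal.span {x} : Ideal A)) wellFounded_lt
  induction e using hwf.induction with
  | _ e ih =>
  by_cases h0 : e = 0
  · exact ⟨PEmpty, inferInstance, PEmpty.elim, fun i => i.elim, fun i => i.elim,
      fun i => i.elim, by simp [h0]⟩
  by_cases hp : IsPrimitiveIdempotent e
  · exact ⟨PUnit, inferInstance, fun _ => e, fun _ => hp, fun _ => he,
      fun i j h => (h rfl).elim, by simp⟩
  obtain ⟨p, hpp, hep, hpe, hp0, hpne⟩ :
      ∃ p, p * p = p ∧ e * p = p ∧ p * e = p ∧ p ≠ 0 ∧ p ≠ e := by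
    by_contra! h
    exact hp ⟨h0, fun p h1 h2 h3 => or_iff_not_imp_left.2 (h p h1 h2 h3)⟩
  have hlt : ∀ q, e * q = q → q * e = q → q * q = q → q ≠ e →
      Ideal.span {q} < (Ideal.span {e} : Ideal A) := by
    intro q h1 h2 h3 h4
    refine lt_of_le_of_ne ((Ideal.span_singleton_le_iff_mem _).2
      (Ideal.mem_span_singleton'.2 ⟨q, h2⟩)) fun h => h4 ?_
    obtain ⟨a, ha⟩ := Ideal.mem_span_singleton'.1
      (h ▸ Ideal.mem_span_singleton_self e : e ∈ (Ideal.span {q} : Ideal A))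
    rw [← h1, ← ha, mul_assoc, h3]
  have hqq : (e - p) * (e - p) = e - p := by
    rw [mul_sub, sub_mul, sub_mul, he, hpp, hep, hpe, sub_self, sub_zero]
  have hpq : p * (e - p) = 0 := by rw [mul_sub, hpe, hpp, sub_self]
  have hqp : (e - p) * p = 0 := by rw [sub_mul, hep, hpp, sub_self]
  obtain ⟨I, _, v, v1, v2, v3, v4⟩ := ih p (hlt p hep hpe hpp hpne) hpp
  obtain ⟨J, _, w, w1, w2, w3, w4⟩ := ih (e - p) (hlt _ (by rw [mul_sub, he, hep])
    (by rw [sub_mul, he, hpe]) hqq (by simpa using hp0)) hqq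
  have hv : ∀ i, v i * p = v i ∧ p * v i = v i := by
    classical
    refine fun i => ⟨?_, ?_⟩
    · rw [← v4, Finset.mul_sum, Finset.sum_eq_single i (fun j _ h => v3 i j h.symm) (by simp), v2]
    · rw [← v4, Finset.sum_mul, Finset.sum_eq_single i (fun j _ h => v3 j i h) (by simp), v2]
  have hw : ∀ i, w i * (e - p) = w i ∧ (e - p) * w i = w i := by
    classical
    refine fun i => ⟨?_, ?_⟩
    · rw [← w4, Finset.mul_sum, Finset.sum_eq_single i (fun j _ h => w3 i j h.symm) (by simp), w2]
    · rw [← w4, Finset.sum_mul, Finset.sum_eq_single i (fun j _ h => w3 j i h) (by simp), w2]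
  refine ⟨I ⊕ J, inferInstance, Sum.elim v w, ?_, ?_, ?_, by simp [v4, w4]⟩
  · rintro (i | j)
    exacts [v1 i, w1 j]
  · rintro (i | j)
    exacts [v2 i, w2 j]
  · rintro (i | i) (j | j) h
    · exact v3 i j fun e => h (congrArg _ e)
    · change v i * w j = 0
      rw [← (hv i).1, ← (hw j).2, mul_assoc, ← mul_assoc p, hpq, zero_mul, mul_zero]
    · change w i * v j = 0
      rw [← (hv j).2, ← (hw i).1, mul_assoc, ← mul_assoc (e - p), hqp, zero_mul, mul_zero]
    · exact w3 i j fun e => h (congrArg _ e)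

end Ring

/-! ### Local endomorphism rings of indecomposable retracts -/

namespace GrMod

variable {G : Type w} [AddGroup G] [DecidableEq G] {R : Type u} [Ring R]
  {𝒜 : G → AddSubgroup R} [GradedRing 𝒜]

/-- P is the direct sum of the kernels of p and 1 - p, which are homogeneous because morphisms
commute with the projections onto components. -/
theorem eq_zero_or_eq_one_of_isIndecomposable {P : GrMod.{u, v, w} 𝒜} (hP : P.IsIndecomposable)
    {p : End P} (hp : p * p = p) : p = 0 ∨ p = 1 := by
  have hpp : ∀ x, p.toLinearMap (p.toLinearMap x) = p.toLinearMap x :=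
    fun x => congr((Hom.toLinearMap $hp) x)
  let q : P ⟶ P := 𝟙 P - (show P ⟶ P from p)
  have hker : ∀ f : P ⟶ P, (LinearMap.ker f.toLinearMap).IsHomogeneous P.grading := by
    intro f g x hx
    change f.toLinearMap (P.proj g x) = 0
    rw [hom_proj, show f.toLinearMap x = 0 from hx, map_zero]
  have hc : IsCompl (LinearMap.ker p.toLinearMap) (LinearMap.ker q.toLinearMap) := by
    refine IsCompl.of_eq (eq_bot_iff.2 fun x hx => ?_) (eq_top_iff.2 fun x _ => ?_)
    · have h1 : p.toLinearMap x = 0 := hx.1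
      have h2 : x - p.toLinearMap x = 0 := hx.2
      rwa [h1, sub_zero] at h2
    · refine Submodule.mem_sup.2 ⟨x - p.toLinearMap x, ?_, p.toLinearMap x, ?_, by simp⟩
      · change p.toLinearMap _ = 0
        rw [map_sub, hpp, sub_self]
      · change p.toLinearMap x - p.toLinearMap (p.toLinearMap x) = 0
        rw [hpp, sub_self]
  rcases hP.2 _ _ (hker p) (hker q) hc with h | h
  · refine Or.inr (hom_ext fun x => sub_eq_zero.1 ?_)
    have : p.toLinearMap x - x ∈ LinearMap.ker p.toLinearMap := by
      rw [LinearMap.mem_ker, map_sub, hpp, sub_self]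
    rw [h] at this
    exact this
  · refine Or.inl (hom_ext fun x => ?_)
    have : p.toLinearMap x ∈ LinearMap.ker q.toLinearMap := by
      change p.toLinearMap x - p.toLinearMap (p.toLinearMap x) = 0
      rw [hpp, sub_self]
    rw [h] at this
    exact this

section Retract

variable {P : GrMod.{u, u, w} 𝒜} {σ : G} (ρ : Retract P ((regular 𝒜).shift σ))

theorem coeff_mem {g : G} {x : P.carrier} (hx : x ∈ P.grading g) : coeff ρ x ∈ 𝒜 (g + σ) :=
  ρ.i.map_mem g x hx

/-- The element of degree zero representing an endomorphism of a retract of a shift of the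
regular module. -/
noncomputable def toZero (f : P ⟶ P) : 𝒜 0 :=
  ⟨coeff ρ (f.toLinearMap (gen ρ)), by
    have := coeff_mem ρ (f.map_mem _ _ (gen_mem ρ))
    rwa [neg_add_cancel] at this⟩

/-- The endomorphism of a retract of a shift of the regular module given by an element of degree
zero. -/
noncomputable def ofZero (a : 𝒜 0) : P ⟶ P :=
  ρ.i ≫ ofElem (M := P) ((a : R) • gen ρ) (g := -σ) (by
    have := SetLike.GradedSMul.smul_mem (A := 𝒜) (B := P.grading) a.2 (gen_mem ρ)
    rwa [vadd_eq_add, zero_add] at this) (add_neg_cancel σ)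

theorem toZero_comp (f g : P ⟶ P) : toZero ρ (f ≫ g) = toZero ρ f * toZero ρ g := by
  refine Subtype.ext ?_
  change coeff ρ (g.toLinearMap (f.toLinearMap (gen ρ))) =
    coeff ρ (f.toLinearMap (gen ρ)) * coeff ρ (g.toLinearMap (gen ρ))
  rw [hom_apply_eq ρ g, map_smul, smul_eq_mul]

theorem toZero_injective : Function.Injective (toZero ρ) := by
  intro f g h
  have h' : coeff ρ (f.toLinearMap (gen ρ)) = coeff ρ (g.toLinearMap (gen ρ)) :=
    congrArg Subtype.val h
  refine hom_ext fun x => ?_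
  rw [hom_apply_eq ρ f, hom_apply_eq ρ g, ← coeff_smul_gen ρ (f.toLinearMap (gen ρ)), h',
    coeff_smul_gen]

/-- With `toZero_comp` and `toZero_injective`, this identifies End P, with composition in
diagrammatic order, with the corner e R_0 e for e = `toZero ρ (𝟙 P)`. -/
theorem toZero_ofZero (a : 𝒜 0) :
    toZero ρ (ofZero ρ a) = toZero ρ (𝟙 P) * a * toZero ρ (𝟙 P) := by
  refine Subtype.ext ?_
  change coeff ρ (coeff ρ (gen ρ) • (a : R) • gen ρ) = coeff ρ (gen ρ) * a * coeff ρ (gen ρ)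
  rw [map_smul, map_smul, smul_eq_mul, smul_eq_mul, mul_assoc]

theorem toZero_pow (f : End P) (n : ℕ) :
    toZero ρ (f ^ n : End P) = toZero ρ (𝟙 P) * toZero ρ f ^ n := by
  have h1 : toZero ρ (𝟙 P) * toZero ρ f = toZero ρ f := by rw [← toZero_comp, Category.id_comp]
  have h2 : toZero ρ f * toZero ρ (𝟙 P) = toZero ρ f := by rw [← toZero_comp, Category.comp_id]
  induction n with
  | zero => rw [pow_zero, pow_zero, mul_one]; rfl
  | succ n ih =>
    rw [pow_succ, End.mul_def, toZero_comp, ih, ← mul_assoc, h2, pow_succ', ← mul_assoc, h1]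

/-- The Fitting idempotent of `toZero ρ f` is carried back to an idempotent p of End P. If p = 0, f
is nilpotent and 1 - f is a unit; if p = 1, a power of f is invertible, and so is f. -/
theorem isLocalRing_end_of_retract (ρ : Retract P ((regular 𝒜).shift σ)) [IsArtinianRing (𝒜 0)]
    (hP : P.IsIndecomposable) :
    IsLocalRing (End P) := by
  have htriv : ∀ p : End P, p * p = p → p = 0 ∨ p = 1 :=
    fun p hp => eq_zero_or_eq_one_of_isIndecomposable hP hp
  have : Nontrivial (End P) := by
    obtain ⟨x, hx⟩ := @exists_ne _ hP.1 (0 : P.carrier)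
    exact ⟨1, 0, fun h => hx congr((Hom.toLinearMap $h) x)⟩
  refine IsLocalRing.of_isUnit_or_isUnit_one_sub_self fun f => ?_
  obtain ⟨n, i, c, hn, hii, hic, hia⟩ := exists_fitting_idempotent (toZero ρ f)
  set e := toZero ρ (𝟙 P) with he
  have hee : e * e = e := by rw [he, ← toZero_comp, Category.id_comp]
  have hae : toZero ρ f * e = toZero ρ f := by rw [he, ← toZero_comp, Category.comp_id]
  have hie : i * e = i := by
    -- A positive power is needed: e absorbs the powers of `toZero ρ f` but need not absorb 1.
    obtain ⟨m, rfl⟩ := Nat.exists_eq_succ_of_ne_zero hn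
    rw [hic, pow_succ, mul_assoc, mul_assoc, hae]
  have hpn := toZero_pow ρ f n
  rw [← he] at hpn
  let p : End P := ofZero ρ i
  have hp : toZero ρ p = e * i := by
    rw [show toZero ρ p = e * i * e from toZero_ofZero ρ i, mul_assoc, hie]
  have hpp : p * p = p := by
    refine toZero_injective ρ ?_
    rw [End.mul_def, toZero_comp, hp, mul_assoc, ← mul_assoc i, hie, hii]
  have hpf : f ^ n * p = f ^ n := by
    refine toZero_injective ρ ?_
    rw [End.mul_def, toZero_comp, hp, hpn, mul_assoc, ← mul_assoc i, hie, hia]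
  rcases htriv p hpp with h | h
  · right
    rw [h, mul_zero] at hpf
    exact IsNilpotent.isUnit_one_sub ⟨n, hpf.symm⟩
  · left
    let g : End P := ofZero ρ c
    have hfg : f ^ n * g = 1 := by
      refine toZero_injective ρ ?_
      rw [End.mul_def, toZero_comp, hpn, show toZero ρ g = e * c * e from toZero_ofZero ρ c,
        mul_assoc, ← mul_assoc e e, hee, mul_assoc]
      have h1 : toZero ρ (1 : End P) = e * i := by rw [← h, hp]
      rw [h1]
      obtain ⟨m, rfl⟩ := Nat.exists_eq_succ_of_ne_zero hn
      have hea : e * toZero ρ f = toZero ρ f := by rw [he, ← toZero_comp, Category.id_comp]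
      rw [hic, pow_succ', ← mul_assoc e (toZero ρ f), hea]
    -- A one-sided inverse is two-sided here, as the product in the other order is a nonzero
    -- idempotent.
    have hgf : g * f ^ n = 1 := by
      refine (htriv (g * f ^ n) ?_).resolve_left fun h0 => ?_
      · rw [mul_assoc, ← mul_assoc (f ^ n) g, hfg, one_mul]
      · have h1 : (1 : End P) = f ^ n * (g * f ^ n) * g := by
          rw [← mul_assoc, hfg, one_mul, hfg]
        rw [h0, mul_zero, zero_mul] at h1
        exact one_ne_zero h1
    exact (isUnit_pow_iff hn).1 ⟨⟨_, g, hfg, hgf⟩, rfl⟩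

end Retract

/-- The regular module is its own shift by zero. -/
noncomputable def regularIsoShift : regular 𝒜 ≅ (regular 𝒜).shift 0 :=
  isoOfBijective ⟨(LinearMap.id : R →ₗ[R] R), fun g m hm => by
    change m ∈ 𝒜 (g + 0)
    rwa [add_zero]⟩ Function.bijective_id

/-- A term of a direct sum is a retract of it. -/
noncomputable def retractDirectSum {I : Type v} (M : I → GrMod.{u, v, w} 𝒜) (i : I) :
    Retract (M i) (directSum M) :=
  ⟨ι M i, π M i, ι_π M i⟩

theorem IsPrincipalIndecomposable.nonempty_retract {P : GrMod.{u, u, w} 𝒜}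
    (hP : P.IsPrincipalIndecomposable) : Nonempty (Retract P (regular 𝒜)) := by
  obtain ⟨I, _, Q, _, ⟨e⟩, i, ⟨e'⟩⟩ := hP
  exact ⟨((Retract.ofIso e').trans (retractDirectSum Q i)).trans (Retract.ofIso e.symm)⟩

theorem IsPrincipalIndecomposable.isCyclicProjective {P : GrMod.{u, u, w} 𝒜}
    (hP : P.IsPrincipalIndecomposable) (σ : G) : IsCyclicProjective (P.shift σ) :=
  ⟨σ, ⟨hP.nonempty_retract.some.grShift σ⟩⟩

/-- Isomorphic objects have isomorphic endomorphism rings. -/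
noncomputable def endEquivOfIso {P Q : GrMod.{u, v, w} 𝒜} (e : P ≅ Q) : End P ≃+* End Q :=
  { e.conj with
    map_add' f g := by
      change e.inv ≫ ((show P ⟶ P from f) + (show P ⟶ P from g)) ≫ e.hom =
        e.inv ≫ f ≫ e.hom + e.inv ≫ g ≫ e.hom
      rw [Preadditive.add_comp, Preadditive.comp_add] }

theorem IsPrincipalIndecomposable.isLocalRing [IsArtinianRing (𝒜 0)] {P : GrMod.{u, u, w} 𝒜}
    (hP : P.IsPrincipalIndecomposable) : IsLocalRing (End P) := by
  obtain ⟨I, _, Q, hQ, ⟨e⟩, i, ⟨e'⟩⟩ := hP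
  have := isLocalRing_end_of_retract
    (((retractDirectSum Q i).trans (Retract.ofIso e.symm)).trans (Retract.ofIso regularIsoShift))
    (hQ i)
  exact IsLocalRing.of_ringEquiv (endEquivOfIso e'.symm)

/-! ### Graded submodules -/

section Sub

variable (M : GrMod.{u, v, w} 𝒜) (N : Submodule R M.carrier) (hN : N.IsHomogeneous M.grading)

theorem sub_isInternal (hN : N.IsHomogeneous M.grading) :
    DirectSum.IsInternal (fun g => (M.grading g).comap N.toAddSubgroup.subtype) := by
  classical
  refine isInternal_of_proj _
    (fun g => ((M.proj g).comp N.toAddSubgroup.subtype).codRestrict N.toAddSubgroup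
      fun x => hN g x.2) ?_ ?_
  · intro g h x hx
    refine Subtype.ext ((M.proj_of_mem g h x hx).trans ?_)
    split_ifs <;> rfl
  · intro x
    have hx : x = ∑ g ∈ (decompose M.grading (x : M.carrier)).support,
        (⟨M.proj g x, hN g x.2⟩ : N.toAddSubgroup) :=
      Subtype.ext (((sum_support_decompose M.grading (x : M.carrier)).symm.trans
        (map_sum N.toAddSubgroup.subtype
          (fun g => (⟨M.proj g x, hN g x.2⟩ : N.toAddSubgroup)) _).symm))
    rw [hx]
    exact sum_mem fun g _ => AddSubgroup.mem_iSup_of_mem g (M.proj_mem g x)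

/-- A homogeneous submodule as a graded module. -/
noncomputable def sub : GrMod.{u, v, w} 𝒜 where
  carrier := N
  grading := fun g => (M.grading g).comap N.toAddSubgroup.subtype
  decomposition := (M.sub_isInternal N hN).chooseDecomposition
  gradedSMul := ⟨fun _ _ _ _ ha hm =>
    SetLike.GradedSMul.smul_mem (A := 𝒜) (B := M.grading) ha hm⟩

/-- The inclusion of a homogeneous submodule. -/
noncomputable def subι : M.sub N hN ⟶ M := ⟨N.subtype, fun _ _ hm => hm⟩

/-- A morphism with values in a homogeneous submodule. -/
noncomputable def subLift {L : GrMod.{u, v, w} 𝒜} (f : L ⟶ M)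
    (hf : ∀ x, f.toLinearMap x ∈ N) : L ⟶ M.sub N hN :=
  ⟨f.toLinearMap.codRestrict N hf, fun g m hm => f.map_mem g m hm⟩

end Sub

/-! ### Decomposition of the regular module -/

/-- The left ideal of elements fixed by right multiplication by `v`. -/
def fixedIdeal (𝒜 : G → AddSubgroup R) [GradedRing 𝒜] (v : R) :
    Submodule R (regular 𝒜).carrier where
  carrier := {x : R | x * v = x}
  zero_mem' := zero_mul v
  add_mem' {a b : R} (ha : a * v = a) (hb : b * v = b) := by
    change (a + b) * v = a + b
    rw [add_mul, ha, hb]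
  smul_mem' (a x : R) (hx : x * v = x) := by
    change a * x * v = a * x
    rw [mul_assoc, hx]

theorem isHomogeneous_fixedIdeal {v : R} (hv : v ∈ 𝒜 0) :
    (fixedIdeal 𝒜 v).IsHomogeneous (regular 𝒜).grading := by
  intro g (x : R) (hx : x * v = x)
  have h := coe_decompose_mul_add_of_right_mem 𝒜 (i := g) hv (a := x)
  rw [add_zero, hx] at h
  exact h.symm

/-- The graded left ideal `R v` for an idempotent `v` of degree zero. -/
noncomputable def idempotentModule (v : 𝒜 0) : GrMod.{u, u, w} 𝒜 :=
  (regular 𝒜).sub (fixedIdeal 𝒜 (v : R)) (isHomogeneous_fixedIdeal v.2)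

/-- Splitting Rv splits its generator v. The component of degree zero of one part is an idempotent
below v, hence 0 or v, and one summand contains v. -/
theorem isIndecomposable_idempotentModule {v : 𝒜 0} (hv : IsPrimitiveIdempotent v)
    (hvv : v * v = v) : (idempotentModule v).IsIndecomposable := by
  let Q := idempotentModule v
  let val : Q.carrier →ₗ[R] R := (fixedIdeal 𝒜 (v : R)).subtype
  have val_inj : Function.Injective val := Subtype.val_injective
  have hval : ∀ x, val x * v = val x := fun x => x.2
  let vv : Q.carrier := ⟨(v : R), congrArg Subtype.val hvv⟩
  have val_vv : val vv = v := rfl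
  have hvv0 : vv ∈ Q.grading 0 := v.2
  have hgen : ∀ x : Q.carrier, val x • vv = x := fun x => val_inj (by
    rw [map_smul, val_vv, smul_eq_mul, hval])
  refine ⟨⟨vv, 0, fun h => hv.ne_zero (Subtype.ext (congrArg val h))⟩, ?_⟩
  intro N N' hN hN' hc
  have htop : ∀ N : Submodule R Q.carrier, vv ∈ N → N = ⊤ := fun N h =>
    eq_top_iff.2 fun x _ => hgen x ▸ N.smul_mem _ h
  obtain ⟨n, hn, n', hn', hnn⟩ : ∃ n ∈ N, ∃ n' ∈ N', n + n' = vv :=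
    Submodule.mem_sup.1 (hc.sup_eq_top ▸ Submodule.mem_top)
  have hm : Q.proj 0 n ∈ N := hN 0 hn
  have hm' : Q.proj 0 n' ∈ N' := hN' 0 hn'
  have hmm : Q.proj 0 n + Q.proj 0 n' = vv := by
    rw [← map_add, hnn, Q.proj_of_mem_same hvv0]
  have hm0 : Q.proj 0 n ∈ Q.grading 0 := Q.proj_mem 0 n
  generalize Q.proj 0 n = m at hm hmm hm0
  generalize Q.proj 0 n' = m' at hm' hmm
  have hdis : ∀ x, x ∈ N → x ∈ N' → x = 0 := Submodule.disjoint_def.1 hc.disjoint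
  have e1 : val m • m + val m • m' = m := by rw [← smul_add, hmm, hgen]
  have e2 : val m' • m + val m' • m' = m' := by rw [← smul_add, hmm, hgen]
  -- mm' lies in N' as a multiple of m', and in N because it equals m - mm. The same with the roles
  -- exchanged gives m'm = 0.
  have h1 : val m • m' = 0 := hdis _
    (by rw [eq_sub_of_add_eq' e1]; exact N.sub_mem hm (N.smul_mem _ hm)) (N'.smul_mem _ hm')
  have h2 : val m' • m = 0 := hdis _ (N.smul_mem _ hm)
    (by rw [eq_sub_of_add_eq e2]; exact N'.sub_mem hm' (N'.smul_mem _ hm'))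
  rw [h1, add_zero] at e1
  have hvm : (v : R) • m = m := by
    rw [← val_vv, ← hmm, map_add, add_smul, e1, h2, add_zero]
  let p : 𝒜 0 := ⟨val m, hm0⟩
  rcases hv.eq_zero_or_eq p (Subtype.ext (congrArg val e1)) (Subtype.ext (congrArg val hvm))
    (Subtype.ext (hval m)) with h | h
  · left
    have : m = 0 := val_inj ((congrArg Subtype.val h).trans (map_zero val).symm)
    rw [this, zero_add] at hmm
    have h' := htop N' (hmm ▸ hm')
    exact (hc.inf_eq_bot ▸ by rw [h', inf_top_eq] : N = ⊥)
  · right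
    have : m = vv := val_inj (congrArg Subtype.val h)
    have h' := htop N (this ▸ hm)
    exact (hc.inf_eq_bot ▸ by rw [h', top_inf_eq] : N' = ⊥)

/-- Right multiplication by an element of degree zero. -/
noncomputable def mulRight (v : 𝒜 0) : regular 𝒜 ⟶ regular 𝒜 :=
  ⟨LinearMap.toSpanSingleton R R (v : R), fun g (m : R) (hm : m ∈ 𝒜 g) => by
    have := SetLike.GradedMul.mul_mem hm v.2
    rw [add_zero] at this
    exact this⟩

theorem exists_regular_iso [IsArtinianRing (𝒜 0)] :
    ∃ (I : Type u) (_ : Finite I) (Q : I → GrMod.{u, u, w} 𝒜),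
      (∀ i, (Q i).IsIndecomposable) ∧ Nonempty (regular 𝒜 ≅ directSum Q) := by
  obtain ⟨I, _, v, hv, hvv, hv0, hsum⟩ :=
    exists_primitive_decomposition.{u} (1 : 𝒜 0) (mul_one 1)
  refine ⟨I, inferInstance, fun i => idempotentModule (v i),
    fun i => isIndecomposable_idempotentModule (hv i) (hvv i), ⟨?_⟩⟩
  refine isoDirectSum (fun i => subι _ _ _) (fun i => subLift _ _ _ (mulRight (v i)) ?_) ?_ ?_ ?_
  · intro (x : R)
    change x * (v i : R) * (v i : R) = x * (v i : R)
    rw [mul_assoc]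
    exact congrArg (x * ·) (congrArg Subtype.val (hvv i))
  · exact fun i => hom_ext fun x => Subtype.ext x.2
  · intro i j hij
    refine hom_ext fun x => Subtype.ext ?_
    let y : R := x.1
    have hy : y * v i = y := x.2
    change y * (v j : R) = 0
    rw [← hy, mul_assoc]
    exact (congrArg (y * ·) (congrArg Subtype.val (hv0 i j hij))).trans (mul_zero _)
  · refine hom_ext fun (x : R) => ?_
    refine (sum_apply (M := regular 𝒜) (N := regular 𝒜) _ _ x).trans ?_
    change ∑ i, x * (v i : R) = x
    rw [← Finset.mul_sum]
    have h1 : ∑ i, (v i : R) = 1 :=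
      (AddSubgroup.val_finsetSum (𝒜 0) _ _).symm.trans (congrArg Subtype.val hsum)
    rw [h1, mul_one]

end GrMod

/-! ### Nakayama's lemma and the decomposition of projective objects -/

theorem Submodule.eq_top_of_sup_smul_eq_top {R M : Type*} [Ring R] [AddCommGroup M] [Module R M]
    {J : Ideal R} {n : ℕ} (hJ : J ^ n = ⊥) {S : Submodule R M}
    (hS : S ⊔ J • (⊤ : Submodule R M) = ⊤) : S = ⊤ := by
  have key : ∀ m : ℕ, S ⊔ J ^ (m + 1) • (⊤ : Submodule R M) = ⊤ := by
    intro m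
    induction m with
    | zero => rwa [zero_add, Submodule.pow_one]
    | succ m ih =>
      refine top_le_iff.1 ?_
      conv_lhs => rw [← ih]
      refine sup_le le_sup_left ?_
      conv_lhs => rw [← hS]
      rw [Submodule.smul_sup, Submodule.pow_succ (n := m + 1), Submodule.mul_smul]
      exact sup_le_sup_right Submodule.smul_le_right _
  have h := key n
  rwa [Submodule.pow_succ, hJ, Submodule.bot_mul, Submodule.bot_smul, sup_bot_eq] at h

namespace GrMod

variable {G : Type w} [AddGroup G] [DecidableEq G] {R : Type u} [Ring R]
  {𝒜 : G → AddSubgroup R} [GradedRing 𝒜]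

/-- f is determined by r, the image of the generator. For s of degree opposite to r, let q send 1 to
s times the generator, so that q ≫ f is right multiplication by sr. Since f ≫ q is not a unit, 1 - f
≫ q is one; passing from it to 1 - q ≫ f and evaluating at 1 gives a left inverse of 1 - sr. -/
theorem apply_mem_gradedRadical {T : GrMod.{u, u, w} 𝒜} [IsLocalRing (End T)] {σ τ : G}
    (ρ : Retract T ((regular 𝒜).shift τ)) {f : T ⟶ (regular 𝒜).shift σ}
    (hf : f ∈ radHom T ((regular 𝒜).shift σ)) (x : T.carrier) :
    (show R from f.toLinearMap x) ∈ gradedRadical 𝒜 := by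
  let r : R := f.toLinearMap (gen ρ)
  have hr : r ∈ 𝒜 (-τ + σ) := f.map_mem _ _ (gen_mem ρ)
  suffices h : r ∈ gradedRadical 𝒜 by
    have h1 : f.toLinearMap x = coeff ρ x * r := hom_apply_eq ρ f x
    rw [h1]
    exact (gradedRadical 𝒜).mul_mem_left _ h
  refine mem_gradedRadical_of hr fun s hs => ?_
  have hsg : s • gen ρ ∈ T.grading (-σ) := by
    have := SetLike.GradedSMul.smul_mem (A := 𝒜) (B := T.grading) hs (gen_mem ρ)
    rwa [vadd_eq_add, neg_add_rev, neg_neg, add_assoc, add_neg_cancel, add_zero] at this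
  let q : (regular 𝒜).shift σ ⟶ T := ofElem (s • gen ρ) hsg (add_neg_cancel σ)
  obtain ⟨b, hb⟩ := (IsLocalRing.isUnit_or_isUnit_of_add_one (R := End T)
    (add_sub_cancel (show End T from f ≫ q) 1)).resolve_left (hf q)
  obtain ⟨c, hb'⟩ : ∃ c : T ⟶ T, c ≫ (𝟙 T - f ≫ q) = 𝟙 T := by
    have h1 : (1 - (show End T from f ≫ q)) * (↑b⁻¹ : End T) = 1 := by rw [← hb, Units.mul_inv]
    exact ⟨_, h1⟩
  let h : (regular 𝒜).shift σ ⟶ (regular 𝒜).shift σ := 𝟙 _ + q ≫ c ≫ f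
  have hh : h ≫ (𝟙 _ - q ≫ f) = 𝟙 _ := by
    have h2 : c = 𝟙 T + c ≫ f ≫ q := by
      rw [Preadditive.comp_sub, Category.comp_id, sub_eq_iff_eq_add] at hb'
      exact hb'
    have h3 : q ≫ c ≫ f = q ≫ f + q ≫ c ≫ f ≫ q ≫ f := by
      conv_lhs => rw [h2]
      simp only [Preadditive.add_comp, Preadditive.comp_add, Category.assoc, Category.id_comp]
    simp only [h, Preadditive.add_comp, Preadditive.comp_sub, Category.assoc, Category.comp_id,
      Category.id_comp]
    conv_lhs => rw [h3]
    abel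
  let z : R := h.toLinearMap (1 : R)
  have hz : z ∈ 𝒜 0 := by
    have := h.map_mem _ _ (one_mem_shift (𝒜 := 𝒜) σ)
    rw [← neg_add_cancel σ]
    exact this
  refine ⟨z, hz, ?_⟩
  have h4 : z - (show R from f.toLinearMap (z • s • gen ρ)) = 1 :=
    congr((Hom.toLinearMap $hh) (1 : R))
  have h5 : (show R from f.toLinearMap (z • s • gen ρ)) = z * (s * r) :=
    (f.toLinearMap.map_smul z _).trans (congrArg (z * ·) (f.toLinearMap.map_smul s _))
  rw [mul_sub, mul_one, ← h5, h4]

/-- The coordinates of f in the free module are radical morphisms to shifts of R, so their values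
lie in J; the retraction sends the resulting combination of basis vectors into JM. -/
theorem apply_mem_gradedRadical_smul {T M : GrMod.{u, u, w} 𝒜} [IsLocalRing (End T)] {τ : G}
    (ρ : Retract T ((regular 𝒜).shift τ)) {K : Type u} {σ : K → G}
    (ρM : Retract M (directSum fun k => (regular 𝒜).shift (σ k))) {f : T ⟶ M}
    (hf : f ∈ radHom T M) (x : T.carrier) :
    f.toLinearMap x ∈ gradedRadical 𝒜 • (⊤ : Submodule R M.carrier) := by
  let X : K → GrMod.{u, u, w} 𝒜 := fun k => (regular 𝒜).shift (σ k)
  let y := ρM.i.toLinearMap (f.toLinearMap x)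
  obtain ⟨s, hs⟩ := exists_eq_sum X y
  have hy : f.toLinearMap x = ρM.r.toLinearMap y :=
    congr((Hom.toLinearMap $ρM.retract) (f.toLinearMap x)).symm
  rw [hy, hs, map_sum]
  refine sum_mem fun k _ => ?_
  rw [← comp_apply]
  refine Set.mem_of_eq_of_mem (hom_apply_regular (ι X k ≫ ρM.r) _) ?_
  refine Submodule.smul_mem_smul ?_ Submodule.mem_top
  exact apply_mem_gradedRadical ρ (f := f ≫ ρM.i ≫ π X k) (comp_mem_radHom hf _) x

/-- Retracts of the terms give a retract of the direct sum. -/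
noncomputable def retractDirectSumMap {I : Type v} {X Y : I → GrMod.{u, v, w} 𝒜}
    (ρ : ∀ i, Retract (X i) (Y i)) : Retract (directSum X) (directSum Y) where
  i := desc fun i => (ρ i).i ≫ ι Y i
  r := desc fun i => (ρ i).r ≫ ι X i
  retract := directSum_hom_ext fun i => by
    rw [← Category.assoc, ι_desc, Category.assoc, ι_desc, Category.comp_id, ← Category.assoc,
      (ρ i).retract, Category.id_comp]

/-- The homogeneous elements of a graded module. -/
def HomogeneousElement (M : GrMod.{u, v, w} 𝒜) : Type v :=
  {m : M.carrier // ∃ g, m ∈ M.grading g}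

/-- A degree of a homogeneous element. -/
noncomputable def HomogeneousElement.deg {M : GrMod.{u, v, w} 𝒜} (m : M.HomogeneousElement) : G :=
  m.2.choose

/-- The morphism from a shift of the regular module given by a homogeneous element. -/
noncomputable def HomogeneousElement.hom {M : GrMod.{u, u, w} 𝒜} (m : M.HomogeneousElement) :
    (regular 𝒜).shift (-m.deg) ⟶ M :=
  ofElem m.1 m.2.choose_spec (neg_add_cancel _)

theorem HomogeneousElement.hom_one {M : GrMod.{u, u, w} 𝒜} (m : M.HomogeneousElement) :
    m.hom.toLinearMap (1 : R) = m.1 := one_smul R m.1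

theorem submodule_eq_top_of_homogeneous {M : GrMod.{u, v, w} 𝒜} {S : Submodule R M.carrier}
    (hS : ∀ m : M.HomogeneousElement, m.1 ∈ S) : S = ⊤ := by
  refine Submodule.eq_top_iff'.2 fun x => ?_
  induction x using DirectSum.Decomposition.inductionOn M.grading with
  | zero => exact zero_mem S
  | @homogeneous g y => exact hS ⟨y, g, y.2⟩
  | add x y hx hy => exact S.add_mem hx hy

/-- Projective objects are retracts of graded free modules. -/
theorem nonempty_retract_of_projective (U : GrMod.{u, u, w} 𝒜) (hU : Projective U) :
    Nonempty (Retract U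
      (directSum fun m : U.HomogeneousElement => (regular 𝒜).shift (-m.deg))) := by
  let p := desc fun m : U.HomogeneousElement => m.hom
  have hp : Function.Surjective p.toLinearMap := by
    rw [← LinearMap.range_eq_top]
    refine submodule_eq_top_of_homogeneous fun m => ?_
    refine ⟨(ι (fun m : U.HomogeneousElement => (regular 𝒜).shift (-m.deg)) m).toLinearMap
      (1 : R), ?_⟩
    exact (descLinearMap_ι (fun m : U.HomogeneousElement => m.hom) m (1 : R)).trans m.hom_one
  have := epi_of_surjective p hp
  exact ⟨⟨Projective.factorThru (𝟙 U) p, p, Projective.factorThru_comp _ _⟩⟩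

/-- Existence of a decomposition of a projective object. -/
theorem exists_iso_directSum (hR : IsGradedLeftArtinian 𝒜) (U : GrMod.{u, u, w} 𝒜)
    (hU : Projective U) :
    ∃ (I : Type u) (Q : I → GrMod.{u, u, w} 𝒜) (σ : I → G),
      (∀ i, (Q i).IsPrincipalIndecomposable) ∧
        Nonempty (U ≅ directSum (fun i => (Q i).shift (σ i))) := by
  have := isArtinianRing_zero hR
  obtain ⟨n, hn⟩ := exists_gradedRadical_pow_eq_bot hR
  obtain ⟨I₀, hI₀, Q, hQ, ⟨e⟩⟩ := exists_regular_iso (𝒜 := 𝒜)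
  have hQp : ∀ i, (Q i).IsPrincipalIndecomposable :=
    fun i => ⟨I₀, hI₀, Q, hQ, ⟨e⟩, i, ⟨Iso.refl _⟩⟩
  have hloc : ∀ i, IsLocalRing (End (Q i)) := fun i => (hQp i).isLocalRing
  -- Only the shifts by degrees of homogeneous elements of U are needed to cover U, and indexing by
  -- these elements, not by G, keeps the index set in universe u.
  let X : U.HomogeneousElement × I₀ → GrMod.{u, u, w} 𝒜 := fun t => (Q t.2).shift (-t.1.deg)
  let ρ : ∀ t, Retract (X t) ((regular 𝒜).shift (-t.1.deg)) :=
    fun t => (hQp t.2).nonempty_retract.some.grShift _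
  have hXloc : ∀ t, IsLocalRing (End (X t)) := fun t =>
    inferInstanceAs (IsLocalRing (End ((Q t.2).shift (-t.1.deg))))
  obtain ⟨ρU⟩ := nonempty_retract_of_projective U hU
  have cover : ∀ S : Submodule R U.carrier,
      (∀ t, ∀ f : X t ⟶ U, ∀ x, f.toLinearMap x ∈ S) → S = ⊤ := by
    intro S hS
    refine submodule_eq_top_of_homogeneous fun m => ?_
    obtain ⟨s, hs⟩ := exists_eq_sum Q (e.hom.toLinearMap (1 : R))
    have h1 : e.inv.toLinearMap (e.hom.toLinearMap (1 : R)) = (1 : R) :=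
      congr((Hom.toLinearMap $e.hom_inv_id) (1 : R))
    rw [hs, map_sum] at h1
    have h2 : m.1 = ∑ i ∈ s, (shiftMap (ι Q i ≫ e.inv) (-m.deg) ≫ m.hom).toLinearMap
        ((π Q i).toLinearMap (e.hom.toLinearMap (1 : R))) := by
      conv_lhs => rw [← m.hom_one, ← h1]
      exact map_sum m.hom.toLinearMap _ _
    rw [h2]
    exact sum_mem fun i _ => hS (m, i) _ _
  obtain ⟨I, k, b, hb⟩ := LocFinDecomposition.exists_family (K := IsCyclicProjective) X
    (fun t => (hQp t.2).isCyclicProjective _) U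
  let F : GrMod.{u, u, w} 𝒜 := directSum fun i => X (k i)
  let φ : F ⟶ U := desc b
  have hφ := hb F (locFinDecomposition _) φ (ι_desc b)
  have hrange : LinearMap.range φ.toLinearMap = ⊤ := by
    refine Submodule.eq_top_of_sup_smul_eq_top hn (cover _ fun t f x => ?_)
    obtain ⟨y, hy⟩ := (hφ t).1 f
    have h1 := apply_mem_gradedRadical_smul (ρ t) ρU hy x
    rw [sub_apply, comp_apply] at h1
    rw [← add_sub_cancel (φ.toLinearMap (y.toLinearMap x)) (f.toLinearMap x)]
    exact Submodule.add_mem_sup ⟨_, rfl⟩ h1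
  have := epi_of_surjective φ (LinearMap.range_eq_top.1 hrange)
  let s : U ⟶ F := Projective.factorThru (𝟙 U) φ
  have hs : s ≫ φ = 𝟙 U := Projective.factorThru_comp _ _
  let p : F ⟶ F := 𝟙 F - φ ≫ s
  have hpφ : p ≫ φ = 0 := by
    rw [Preadditive.sub_comp, Category.assoc, hs, Category.id_comp, Category.comp_id, sub_self]
  have hpp : p ≫ p = p := by
    change p ≫ (𝟙 F - φ ≫ s) = p
    rw [Preadditive.comp_sub, ← Category.assoc, hpφ, Limits.zero_comp, sub_zero, Category.comp_id]
  -- On each summand p is killed by φ, hence radical by injectivity of φ modulo radical morphisms.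
  have hpJ : ∀ y, p.toLinearMap y ∈ gradedRadical 𝒜 • (⊤ : Submodule R F.carrier) := by
    intro y
    obtain ⟨s, hs⟩ := exists_eq_sum (fun i => X (k i)) y
    rw [hs, map_sum]
    refine sum_mem fun i _ => ?_
    rw [← comp_apply]
    refine apply_mem_gradedRadical_smul (ρ (k i)) (retractDirectSumMap fun i => ρ (k i))
      ((hφ (k i)).2 _ ?_) _
    rw [Category.assoc, hpφ, Limits.comp_zero]
    exact zero_mem _
  have hker : LinearMap.ker p.toLinearMap = ⊤ := by
    refine Submodule.eq_top_of_sup_smul_eq_top hn (Submodule.eq_top_iff'.2 fun y => ?_)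
    -- Since p is idempotent, y - p y is in its kernel, so ker p + JF = F.
    rw [← sub_add_cancel y (p.toLinearMap y)]
    refine Submodule.add_mem_sup ?_ (hpJ y)
    rw [LinearMap.mem_ker, map_sub, ← comp_apply, hpp, sub_self]
  have hp0 : φ ≫ s = 𝟙 F := by
    have : p = 0 := hom_ext fun x => (hker ▸ Submodule.mem_top : x ∈ LinearMap.ker p.toLinearMap)
    exact (sub_eq_zero.1 this).symm
  exact ⟨I, fun i => Q (k i).2, fun i => -(k i).1.deg, fun i => hQp _, ⟨⟨s, φ, hs, hp0⟩⟩⟩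

end GrMod

theorem theorem4p8 {G : Type w} [AddGroup G] [DecidableEq G] {R : Type u} [Ring R]
    (𝒜 : G → AddSubgroup R) [GradedRing 𝒜] (hR : IsGradedLeftArtinian 𝒜) :
    (∀ P : GrMod.{u, u, w} 𝒜, Projective P →
      ∃ (I : Type u) (Q : I → GrMod.{u, u, w} 𝒜) (σ : I → G),
        (∀ i, (Q i).IsPrincipalIndecomposable) ∧
          Nonempty (P ≅ GrMod.directSum (fun i => (Q i).shift (σ i)))) ∧
    (∀ (I J : Type u) (Q : I → GrMod.{u, u, w} 𝒜) (σ : I → G)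
      (Q' : J → GrMod.{u, u, w} 𝒜) (τ : J → G),
      (∀ i, (Q i).IsPrincipalIndecomposable) → (∀ j, (Q' j).IsPrincipalIndecomposable) →
      Nonempty (GrMod.directSum (fun i => (Q i).shift (σ i)) ≅
        GrMod.directSum (fun j => (Q' j).shift (τ j))) →
      ∃ e : I ≃ J, ∀ i, Nonempty ((Q i).shift (σ i) ≅ (Q' (e i)).shift (τ (e i)))) := by
  refine ⟨fun P hP => GrMod.exists_iso_directSum hR P hP, ?_⟩
  rintro I J Q σ Q' τ hQ hQ' ⟨e⟩
  have := GrMod.isArtinianRing_zero hR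
  have h1 : ∀ i, IsLocalRing (End (Q i)) := fun i => (hQ i).isLocalRing
  have h2 : ∀ j, IsLocalRing (End (Q' j)) := fun j => (hQ' j).isLocalRing
  exact LocFinDecomposition.exists_equiv
    ((GrMod.locFinDecomposition fun i => (Q i).shift (σ i)).ofIso e)
    (GrMod.locFinDecomposition fun j => (Q' j).shift (τ j))
    (fun i => (hQ i).isCyclicProjective _) fun j => (hQ' j).isCyclicProjective _
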